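/- Let $n\ge 2$ and let $B_r=B(x_0,r)$ denote the open balls in $\mathbb R^n$ with a fixed centre $x_0$. Let $p\colon\mathbb R^n\to[1,\infty)$ be a bounded variable exponent, $p^+:=\operatorname{ess\,sup}_{\mathbb R^n}p<\infty$, such that $1/p$ is log-Hölder continuous, i.e. for some $L>0$ $$\Big|\frac1{p(x)}-\frac1{p(y)}\Big|\le\frac{L}{\log(e+1/|x-y|)}\qquad\text{for all }x,y\in\mathbb R^n .$$ Let $\mathcal A\colon\mathbb R^n\times\mathbb R\times\mathbb R^n\to\mathbb R^n$ be a Carathéodory function (measurable in the first variable and continuous in the last two) of $p(\cdot)$-growth: there are measurable functions $a,b\colon\mathbb R^n\to\mathbb R$ and constants $a_->0$, $b^+<\infty$ with $a_-\le a\le b\le b^+$ such that for all $(x,t,\xi)$ $$\langle\mathcal A(x,t,\xi),\xi\rangle\ge a(x)|\xi|^{p(x)},\qquad |\mathcal A(x,t,\xi)|\le b(x)|\xi|^{p(x)-1}.$$ Suppose that there are a constant $q$ with $1\le q\le p^+$ and an increasing sequence of radii $R_k>0$ with $R_k\to\infty$ such that $p=q$ on $B_{2R_k}\setminus B_{R_k}$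 for every $k$. Let $u$ be $\mathcal A$-harmonic on $\mathbb R^n$, that is, $u$ is continuous, $u\in W^{1,p(\cdot)}_{\mathrm{loc}}(\mathbb R^n)$ (so $u$ has a distributional gradient $\nabla u$, and on every compact set $K$ both $u$ and $\nabla u$ belong to $L^{p(\cdot)}(K)$, the space of measurable $f$ with $\int_K|f/\mu|^{p(x)}\,dx<\infty$ for some $\mu>0$), and $$\int_{\mathbb R^n}\langle\mathcal A(x,u,\nabla u),\nabla\varphi\rangle\,dx=0\qquad\text{for all }\varphi\in C_0^\infty(\mathbb R^n).$$ If $\int_{\mathbb R^n}|\nabla u|^{p(x)}\,dx<\infty$, then $u$ is constant. -/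

import Mathlib

open MeasureTheory Set Filter Topology
open scoped ENNReal ContDiff Gradient

noncomputable section

/-- Euclidean `n`-space. -/
abbrev Rn (n : ℕ) : Type := EuclideanSpace ℝ (Fin n)

variable {n : ℕ}

/-- Log-Hölder continuity of a real function on `ℝⁿ`. (For `x = y` both conventions for `1 / 0`
give a true inequality.) -/
def IsLogHolder (α : Rn n → ℝ) : Prop :=
  ∃ L : ℝ, 0 < L ∧ ∀ x y : Rn n,
    |α x - α y| ≤ L / Real.log (Real.exp 1 + 1 / ‖x - y‖)

/-- A bounded variable exponent `p : ℝⁿ → [1, ∞)` such that `1 / p` is log-Hölder continuous. -/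
structure IsLogHolderExponent (p : Rn n → ℝ) : Prop where
  one_le : ∀ x, 1 ≤ p x
  bddAbove : BddAbove (range p)
  logHolder : IsLogHolder (fun x => 1 / p x)

/-- The modular `∫_S |f(x)|^{p(x)} dx`, with values in `[0, ∞]`. -/
def varModular {F : Type*} [NormedAddCommGroup F]
    (p : Rn n → ℝ) (S : Set (Rn n)) (f : Rn n → F) : ℝ≥0∞ :=
  ∫⁻ x in S, ‖f x‖ₑ ^ p x

/-- The variable exponent Lebesgue space `L^{p(·)}(S)`: measurable functions on `S` such that the
modular of `f / μ` is finite for some `μ > 0`. -/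
def MemVarLp {F : Type*} [NormedAddCommGroup F] [NormedSpace ℝ F]
    (p : Rn n → ℝ) (S : Set (Rn n)) (f : Rn n → F) : Prop :=
  AEStronglyMeasurable f (volume.restrict S) ∧
    ∃ μ : ℝ, 0 < μ ∧ varModular p S (fun x => μ⁻¹ • f x) < ⊤

/-- `g` is the distributional gradient of `u` on `ℝⁿ`. -/
structure IsWeakGradient (u : Rn n → ℝ) (g : Rn n → Rn n) : Prop where
  locallyIntegrable : LocallyIntegrable u volume
  locallyIntegrable_grad : LocallyIntegrable g volume
  integral_eq : ∀ φ : Rn n → ℝ, ContDiff ℝ ∞ φ → HasCompactSupport φ →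
    ∫ x, u x • ∇ φ x = - ∫ x, φ x • g x

/-- `u` belongs to `W^{1,p(·)}_loc(ℝⁿ)` and its distributional gradient is `g`. -/
structure IsVarSobolevLoc (p : Rn n → ℝ) (u : Rn n → ℝ) (g : Rn n → Rn n) : Prop where
  weakGradient : IsWeakGradient u g
  memVarLp : ∀ K : Set (Rn n), IsCompact K → MemVarLp p K u
  memVarLp_grad : ∀ K : Set (Rn n), IsCompact K → MemVarLp p K g

/-- A Carathéodory function: (Lebesgue) measurable in `x`, continuous in `(t, ξ)`. -/
structure IsCaratheodory (A : Rn n → ℝ → Rn n → Rn n) : Prop where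
  measurable : ∀ (t : ℝ) (ξ : Rn n), AEStronglyMeasurable (fun x => A x t ξ) volume
  continuous : ∀ x : Rn n, Continuous (fun z : ℝ × Rn n => A x z.1 z.2)

/-- A Carathéodory function of `p(·)`-growth (nonstandard growth). -/
structure HasVarGrowth (p : Rn n → ℝ) (A : Rn n → ℝ → Rn n → Rn n) : Prop where
  caratheodory : IsCaratheodory A
  growth : ∃ a b : Rn n → ℝ, AEMeasurable a volume ∧ AEMeasurable b volume ∧
    (∃ aMinus : ℝ, 0 < aMinus ∧ ∀ x, aMinus ≤ a x) ∧
    (∃ bPlus : ℝ, ∀ x, b x ≤ bPlus) ∧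
    (∀ x, a x ≤ b x) ∧
    (∀ x t ξ, a x * ‖ξ‖ ^ p x ≤ inner ℝ (A x t ξ) ξ) ∧
    (∀ x t ξ, ‖A x t ξ‖ ≤ b x * ‖ξ‖ ^ (p x - 1))

/-- `u` is an `A`-harmonic function on `ℝⁿ` and `g` is its weak gradient: `u` is continuous,
belongs to `W^{1,p(·)}_loc(ℝⁿ)` and is a weak solution of `div A(x, u, ∇u) = 0`. When `A` is
of `p(·)`-growth the integrand below is integrable for every test function `φ`. -/
structure IsAHarmonic (p : Rn n → ℝ) (A : Rn n → ℝ → Rn n → Rn n)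
    (u : Rn n → ℝ) (g : Rn n → Rn n) : Prop where
  continuous : Continuous u
  sobolev : IsVarSobolevLoc p u g
  weak_eq : ∀ φ : Rn n → ℝ, ContDiff ℝ ∞ φ → HasCompactSupport φ →
    ∫ x, inner ℝ (A x (u x) (g x)) (∇ φ x) = 0

end

/-! Test the equation with `(u - c) η`, where `η` is a cutoff equal to `1` on `B_R` whose gradient
has size `O(1/R)` and lives in the annulus `B_{2R} \ B_R`. The lower growth bound turns one side
into at least a multiple of the energy of `u` in `B_R`. The other side is an integral over the
annulus of at most `|∇u|^{q-1} |u - c| / R`, because `p = q` there. Young's inequality with the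
constant exponent `q`, and a Poincaré inequality whose constant does not depend on the scale, bound
it by a multiple of the energy in the annulus (`exists_energy_ball_le`). So the energy in `B_R` is
controlled by the energy outside `B_R`. Along `R = R_k` the latter is the tail of a convergent
integral, hence the total energy vanishes, `∇u = 0` almost everywhere and `u` is constant.

Two points need work. The Poincaré inequality (`exists_poincare_annulus`) comes from double
integrals of `|v x - v y|^q`: these are estimated on balls along segments, chained through a
connected open set (`OscControl.of_isCompact`), rescaled, and carried over to weakly differentiable
functions by mollification. The annulus is connected because `2 ≤ n`.

The function `(u - c) η` is not smooth, so `u` is replaced by its mollifications and the limit is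
taken (`integral_inner_eq_of_weak_eq`). This is where log-Hölder continuity enters: it gives a
pointwise Jensen inequality with variable exponent (`exists_norm_mollify_rpow_le`), whose right-hand
side is a convergent family of majorants (`tendsto_integral_of_tendsto_dominating`). -/

/-! ### Mollification as averaging against a probability measure. -/

section Mollification

open ContinuousLinearMap Metric
open scoped Convolution

variable {F : Type*} [NormedAddCommGroup F] [NormedSpace ℝ F]

/-- Convolution with a normalized bump function. -/
noncomputable def mollify (φ : ContDiffBump (0 : Rn n)) (f : Rn n → F) : Rn n → F :=
  φ.normed volume ⋆[lsmul ℝ ℝ, volume] f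

/-- The probability measure with density the normalized bump function. -/
noncomputable def bumpMeasure (φ : ContDiffBump (0 : Rn n)) : Measure (Rn n) :=
  volume.withDensity fun t => ENNReal.ofReal (φ.normed volume t)

theorem measurable_ofReal_normed (φ : ContDiffBump (0 : Rn n)) :
    Measurable fun t => ENNReal.ofReal (φ.normed volume t) :=
  φ.continuous_normed.measurable.ennreal_ofReal

instance (φ : ContDiffBump (0 : Rn n)) : IsProbabilityMeasure (bumpMeasure φ) where
  measure_univ := by
    rw [bumpMeasure, withDensity_apply _ MeasurableSet.univ, Measure.restrict_univ,
      ← ofReal_integral_eq_lintegral_ofReal φ.integrable_normed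
        (Eventually.of_forall φ.nonneg_normed), φ.integral_normed, ENNReal.ofReal_one]

theorem bumpMeasure_absolutelyContinuous (φ : ContDiffBump (0 : Rn n)) :
    bumpMeasure φ ≪ volume :=
  withDensity_absolutelyContinuous _ _

theorem ae_bumpMeasure_mem_ball (φ : ContDiffBump (0 : Rn n)) :
    ∀ᵐ t ∂bumpMeasure φ, t ∈ ball (0 : Rn n) φ.rOut := by
  rw [bumpMeasure, ae_withDensity_iff (measurable_ofReal_normed φ)]
  refine Eventually.of_forall fun t ht => ?_
  rw [← φ.support_normed_eq (μ := volume), Function.mem_support]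
  rintro h
  simp [h] at ht

theorem mollify_apply (φ : ContDiffBump (0 : Rn n)) (f : Rn n → F) (x : Rn n) :
    mollify φ f x = ∫ t, f (x - t) ∂bumpMeasure φ := by
  rw [bumpMeasure, integral_withDensity_eq_integral_toReal_smul (measurable_ofReal_normed φ)
    (Eventually.of_forall fun _ => ENNReal.ofReal_lt_top)]
  simp [mollify, convolution_def, φ.nonneg_normed]

theorem lintegral_bumpMeasure (φ : ContDiffBump (0 : Rn n)) (f : Rn n → ℝ≥0∞) :
    ∫⁻ t, f t ∂bumpMeasure φ = ∫⁻ t, ENNReal.ofReal (φ.normed volume t) * f t := by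
  rw [bumpMeasure, lintegral_withDensity_eq_lintegral_mul_non_measurable _
    (measurable_ofReal_normed φ) (Eventually.of_forall fun _ => ENNReal.ofReal_lt_top)]
  rfl

theorem aestronglyMeasurable_comp_sub_bumpMeasure {E : Type*} [TopologicalSpace E]
    (φ : ContDiffBump (0 : Rn n)) {f : Rn n → E}
    (hf : AEStronglyMeasurable f volume) (x : Rn n) :
    AEStronglyMeasurable (fun t => f (x - t)) (bumpMeasure φ) :=
  (hf.comp_quasiMeasurePreserving
    (quasiMeasurePreserving_sub_left_of_right_invariant volume x)).mono_ac
      (bumpMeasure_absolutelyContinuous φ)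

theorem lintegral_rpow_le_of_isProbabilityMeasure {α : Type*} [MeasurableSpace α]
    {μ : Measure α} [IsProbabilityMeasure μ] {f : α → ℝ≥0∞} (hf : AEMeasurable f μ)
    {q : ℝ} (hq : 1 ≤ q) : (∫⁻ t, f t ∂μ) ^ q ≤ ∫⁻ t, f t ^ q ∂μ := by
  have h := eLpNorm'_le_eLpNorm'_of_exponent_le (μ := μ) (f := f) one_pos hq
    hf.aestronglyMeasurable
  simp only [eLpNorm', enorm_eq_self, ENNReal.rpow_one, one_div, inv_one] at h
  have := ENNReal.rpow_le_rpow h (zero_le_one.trans hq)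
  rwa [← ENNReal.rpow_mul, inv_mul_cancel₀ (by positivity), ENNReal.rpow_one] at this

theorem enorm_mollify_rpow_le (φ : ContDiffBump (0 : Rn n)) {f : Rn n → F}
    (hf : AEStronglyMeasurable f volume) {q : ℝ} (hq : 1 ≤ q) (x : Rn n) :
    ‖mollify φ f x‖ₑ ^ q ≤ ∫⁻ t, ‖f (x - t)‖ₑ ^ q ∂bumpMeasure φ := by
  rw [mollify_apply]
  refine (ENNReal.rpow_le_rpow (enorm_integral_le_lintegral_enorm _)
    (zero_le_one.trans hq)).trans ?_
  exact lintegral_rpow_le_of_isProbabilityMeasure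
    (aestronglyMeasurable_comp_sub_bumpMeasure φ hf x).enorm hq

/-- Jensen's inequality at each point, then Tonelli: translating `s` by a vector in the support of
the bump stays inside `U`. The constant is `1`, whatever the mollifier. -/
theorem setLIntegral_enorm_mollify_rpow_le (φ : ContDiffBump (0 : Rn n)) {f : Rn n → F}
    (hf : AEStronglyMeasurable f volume) {q : ℝ} (hq : 1 ≤ q) {s U : Set (Rn n)}
    (hs : MeasurableSet s) (hU : MeasurableSet U) (hsU : ∀ x ∈ s, ball x φ.rOut ⊆ U) :
    ∫⁻ x in s, ‖mollify φ f x‖ₑ ^ q ≤ ∫⁻ x in U, ‖f x‖ₑ ^ q := by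
  have hm : AEMeasurable (fun z : Rn n × Rn n => ‖f (z.1 - z.2)‖ₑ ^ q)
      ((volume.restrict s).prod (bumpMeasure φ)) := by
    have h1 : AEStronglyMeasurable (fun z : Rn n × Rn n => f (z.1 - z.2))
        (volume.prod volume) :=
      hf.comp_quasiMeasurePreserving (quasiMeasurePreserving_sub volume volume)
    exact ((h1.mono_ac (Measure.AbsolutelyContinuous.prod Measure.restrict_le_self.absolutelyContinuous
      (bumpMeasure_absolutelyContinuous φ))).enorm).pow_const q
  calc ∫⁻ x in s, ‖mollify φ f x‖ₑ ^ q
      ≤ ∫⁻ x in s, ∫⁻ t, ‖f (x - t)‖ₑ ^ q ∂bumpMeasure φ :=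
        lintegral_mono fun x => enorm_mollify_rpow_le φ hf hq x
    _ = ∫⁻ t, (∫⁻ x in s, ‖f (x - t)‖ₑ ^ q) ∂bumpMeasure φ := lintegral_lintegral_swap hm
    _ ≤ ∫⁻ _, (∫⁻ x in U, ‖f x‖ₑ ^ q) ∂bumpMeasure φ := by
        refine lintegral_mono_ae ?_
        filter_upwards [ae_bumpMeasure_mem_ball φ] with t ht
        rw [← lintegral_indicator hs, ← lintegral_indicator hU,
          ← lintegral_sub_right_eq_self (fun x => U.indicator (fun x => ‖f x‖ₑ ^ q) x) t]
        refine lintegral_mono fun x => ?_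
        by_cases hx : x ∈ s
        · have : x - t ∈ U := hsU x hx (by simpa [dist_eq_norm] using ht)
          simp [hx, this]
        · simp [hx]
    _ = ∫⁻ x in U, ‖f x‖ₑ ^ q := by simp

theorem contDiff_mollify (φ : ContDiffBump (0 : Rn n)) {f : Rn n → F}
    (hf : LocallyIntegrable f volume) : ContDiff ℝ ∞ (mollify φ f) :=
  φ.hasCompactSupport_normed.contDiff_convolution_left _ φ.contDiff_normed hf

/-- The derivative of the convolution falls on the kernel. The reflected kernel `t ↦ φ (x - t)` is a
test function, and the sign from the reflection cancels the one in the definition of the weak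
gradient. -/
theorem hasGradientAt_mollify (φ : ContDiffBump (0 : Rn n)) {u : Rn n → ℝ} {g : Rn n → Rn n}
    (h : IsWeakGradient u g) (x : Rn n) :
    HasGradientAt (mollify φ u) (mollify φ g x) x := by
  have hc := φ.hasCompactSupport_normed (μ := volume)
  have hd := hc.hasFDerivAt_convolution_left (lsmul ℝ ℝ) (φ.contDiff_normed (n := 1))
    h.locallyIntegrable x
  rw [hasGradientAt_iff_hasFDerivAt]
  suffices hs : InnerProductSpace.toDual ℝ (Rn n) (mollify φ g x) =
      (fderiv ℝ (φ.normed volume) ⋆[precompL (Rn n) (lsmul ℝ ℝ), volume] u) x by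
    rw [hs]; exact hd
  set ψ : Rn n → ℝ := fun t => φ.normed volume (x - t) with hψ
  have hψs : ContDiff ℝ ∞ ψ := φ.contDiff_normed.comp (contDiff_const.sub contDiff_id)
  have hψc : HasCompactSupport ψ := hc.comp_homeomorph (Homeomorph.subLeft x)
  have hw := h.integral_eq ψ hψs hψc
  have hgrad : ∀ t, ∇ ψ t = -∇ (φ.normed volume) (x - t) := fun t => by
    have h2 : HasFDerivAt (φ.normed volume) (fderiv ℝ (φ.normed volume) (x - t)) (x - t) :=
      ((φ.contDiff_normed (n := 1)).differentiable one_ne_zero _).hasFDerivAt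
    have h3 := h2.comp t ((hasFDerivAt_id t).const_sub x)
    have : fderiv ℝ ψ t = -fderiv ℝ (φ.normed volume) (x - t) := by
      rw [show ψ = φ.normed volume ∘ (fun s => x - s) from rfl]
      refine h3.fderiv.trans ?_
      ext; simp
    rw [gradient, gradient, this, map_neg]
  have hm : mollify φ g x = ∫ t, ψ t • g t := by
    simp only [mollify, convolution_eq_swap, lsmul_apply, hψ]
  have hI : Integrable (fun t => u t • ∇ ψ t) volume := by
    have hgc : Continuous (∇ ψ) :=
      (InnerProductSpace.toDual ℝ (Rn n)).symm.continuous.comp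
        (hψs.continuous_fderiv (by simp))
    have hgs : HasCompactSupport (∇ ψ) :=
      (hψc.fderiv ℝ).comp_left (g := (InnerProductSpace.toDual ℝ (Rn n)).symm) (map_zero _)
    exact h.locallyIntegrable.integrable_smul_right_of_hasCompactSupport hgc hgs
  have hm2 : mollify φ g x = ∫ t, u t • ∇ (φ.normed volume) (x - t) := by
    rw [hm, ← neg_neg (∫ t, ψ t • g t), ← hw, ← integral_neg]
    simp [hgrad]
  rw [hm2]
  simp only [hgrad, smul_neg] at hI
  have hI' := hI.neg
  simp only [Pi.neg_def, neg_neg] at hI'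
  have e := (InnerProductSpace.toDual ℝ (Rn n)).toContinuousLinearEquiv.toContinuousLinearMap.integral_comp_comm hI'
  refine e.symm.trans ?_
  rw [convolution_eq_swap]
  refine integral_congr_ae (Eventually.of_forall fun t => ?_)
  ext w
  simp [gradient, mul_comm]

end Mollification

/-! ### Oscillation estimates for smooth functions by chaining. -/

section Poincare

/-- The `q`-oscillation of a function over a pair of sets. -/
noncomputable def pairOsc (q : ℝ) (v : Rn n → ℝ) (S T : Set (Rn n)) : ℝ≥0∞ :=
  ∫⁻ x in S, ∫⁻ y in T, ‖v x - v y‖ₑ ^ q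

/-- The `q`-oscillation over the pair `(S, T)` is controlled by the `q`-energy over `U`,
uniformly for all continuously differentiable functions. -/
def OscControl (q : ℝ) (U S T : Set (Rn n)) : Prop :=
  ∃ C : ℝ≥0∞, C ≠ ⊤ ∧ ∀ v : Rn n → ℝ, ContDiff ℝ 1 v →
    pairOsc q v S T ≤ C * ∫⁻ x in U, ‖fderiv ℝ v x‖ₑ ^ q

theorem measurable_enorm_sub_rpow {v : Rn n → ℝ} (hv : Continuous v) (q : ℝ) :
    Measurable fun z : Rn n × Rn n => ‖v z.1 - v z.2‖ₑ ^ q :=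
  (by fun_prop : Continuous fun z : Rn n × Rn n => v z.1 - v z.2).enorm.measurable.pow_const q

theorem pairOsc_comm {v : Rn n → ℝ} (hv : Continuous v) (q : ℝ) (S T : Set (Rn n)) :
    pairOsc q v S T = pairOsc q v T S := by
  rw [pairOsc, lintegral_lintegral_swap (measurable_enorm_sub_rpow hv q).aemeasurable, pairOsc]
  refine lintegral_congr fun y => lintegral_congr fun x => ?_
  rw [← enorm_neg, neg_sub]

theorem pairOsc_mono (q : ℝ) (v : Rn n → ℝ) {S S' T T' : Set (Rn n)} (hS : S ⊆ S')
    (hT : T ⊆ T') : pairOsc q v S T ≤ pairOsc q v S' T' :=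
  (lintegral_mono_set hS).trans (lintegral_mono fun _ => lintegral_mono_set hT)

namespace OscControl

variable {q : ℝ} {U S S' T T' W : Set (Rn n)}

theorem mono (h : OscControl q U S' T') (hS : S ⊆ S') (hT : T ⊆ T') : OscControl q U S T :=
  let ⟨C, hC, H⟩ := h
  ⟨C, hC, fun v hv => (pairOsc_mono q v hS hT).trans (H v hv)⟩

theorem symm (h : OscControl q U S T) : OscControl q U T S :=
  let ⟨C, hC, H⟩ := h
  ⟨C, hC, fun v hv => (pairOsc_comm hv.continuous q T S).trans_le (H v hv)⟩

theorem union_left (h : OscControl q U S T) (h' : OscControl q U S' T) :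
    OscControl q U (S ∪ S') T := by
  obtain ⟨C, hC, H⟩ := h
  obtain ⟨C', hC', H'⟩ := h'
  refine ⟨C + C', ENNReal.add_ne_top.2 ⟨hC, hC'⟩, fun v hv => ?_⟩
  rw [add_mul]
  exact (lintegral_union_le _ S S').trans (add_le_add (H v hv) (H' v hv))

/-- Go from `x ∈ S` to `z ∈ T` through `y ∈ W` and integrate the triangle inequality over `y`. This
costs a factor `1 / |W|`, hence the conditions on `volume W`. -/
theorem trans (hq : 1 ≤ q) (h : OscControl q U S W) (h' : OscControl q U W T)
    (hW : volume W ≠ 0) (hW' : volume W ≠ ⊤) (hS : volume S ≠ ⊤) (hT : volume T ≠ ⊤) :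
    OscControl q U S T := by
  obtain ⟨C, hC, H⟩ := h
  obtain ⟨C', hC', H'⟩ := h'
  refine ⟨(volume W)⁻¹ * (2 ^ (q - 1) * (volume T * C + volume S * C')), ?_, fun v hv => ?_⟩
  · refine ENNReal.mul_ne_top (ENNReal.inv_ne_top.2 hW) (ENNReal.mul_ne_top
      (ENNReal.rpow_ne_top_of_nonneg (by linarith) (by simp)) (ENNReal.add_ne_top.2
      ⟨ENNReal.mul_ne_top hT hC, ENNReal.mul_ne_top hS hC'⟩))
  set E := ∫⁻ x in U, ‖fderiv ℝ v x‖ₑ ^ q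
  have hm := measurable_enorm_sub_rpow hv.continuous q
  have hm1 : ∀ x, Measurable fun y => ‖v x - v y‖ₑ ^ q := fun x =>
    hm.comp measurable_prodMk_left
  have hm2 : Measurable fun x => ∫⁻ y in W, ‖v x - v y‖ₑ ^ q := hm.lintegral_prod_right'
  have key : ∀ x z, volume W * ‖v x - v z‖ₑ ^ q ≤
      2 ^ (q - 1) * ((∫⁻ y in W, ‖v x - v y‖ₑ ^ q) + ∫⁻ y in W, ‖v z - v y‖ₑ ^ q) := by
    intro x z
    rw [← lintegral_add_left (hm1 x), ← lintegral_const_mul _ (by exact (hm1 x).add (hm1 z)),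
      mul_comm, ← setLIntegral_const]
    refine lintegral_mono fun y => ?_
    refine (ENNReal.rpow_le_rpow ?_ (zero_le_one.trans hq)).trans
      (ENNReal.rpow_add_le_mul_rpow_add_rpow _ _ hq)
    rw [← sub_add_sub_cancel (v x) (v y) (v z), ← enorm_neg (v z - v y), neg_sub]
    exact enorm_add_le _ _
  have hint : volume W * pairOsc q v S T ≤
      2 ^ (q - 1) * (volume T * pairOsc q v S W + volume S * pairOsc q v T W) := by
    calc volume W * pairOsc q v S T
        = ∫⁻ x in S, ∫⁻ z in T, volume W * ‖v x - v z‖ₑ ^ q := by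
          rw [pairOsc, ← lintegral_const_mul' _ _ hW']
          refine lintegral_congr fun x => ?_
          rw [lintegral_const_mul' _ _ hW']
      _ ≤ ∫⁻ x in S, ∫⁻ z in T, 2 ^ (q - 1) * ((∫⁻ y in W, ‖v x - v y‖ₑ ^ q) +
            ∫⁻ y in W, ‖v z - v y‖ₑ ^ q) :=
          lintegral_mono fun x => lintegral_mono fun z => key x z
      _ = ∫⁻ x in S, 2 ^ (q - 1) * ((∫⁻ y in W, ‖v x - v y‖ₑ ^ q) * volume T +
            pairOsc q v T W) := by
          refine lintegral_congr fun x => ?_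
          rw [lintegral_const_mul _ (hm2.const_add _), lintegral_add_left measurable_const,
            setLIntegral_const]
          rfl
      _ = _ := by
          rw [lintegral_const_mul _ ((hm2.mul_const _).add_const _),
            lintegral_add_left (hm2.mul_const _), lintegral_mul_const _ hm2, setLIntegral_const,
            pairOsc, pairOsc, mul_comm (volume T), mul_comm (volume S)]
  rw [mul_assoc, ← ENNReal.div_eq_inv_mul, ENNReal.le_div_iff_mul_le (Or.inl hW) (Or.inl hW'),
    mul_comm]
  refine hint.trans ?_
  rw [mul_assoc, add_mul, mul_assoc, mul_assoc, pairOsc_comm hv.continuous q T W]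
  gcongr
  · exact H v hv
  · exact H' v hv

end OscControl

/-- The fundamental theorem of calculus along the segment from `y` to `x`, followed by Jensen's
inequality on `[0, 1]`. -/
theorem enorm_sub_rpow_le_lintegral_segment {v : Rn n → ℝ} (hv : ContDiff ℝ 1 v) {q : ℝ}
    (hq : 1 ≤ q) (x y : Rn n) :
    ‖v x - v y‖ₑ ^ q ≤ ‖x - y‖ₑ ^ q *
      ∫⁻ t in Icc (0 : ℝ) 1, ‖fderiv ℝ v (y + t • (x - y))‖ₑ ^ q := by
  have hl : ContDiff ℝ 1 fun t : ℝ => y + t • (x - y) := by fun_prop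
  have h1 := enorm_sub_le_lintegral_deriv_of_contDiffOn_Icc
    (f := fun t : ℝ => v (y + t • (x - y))) (hv.comp hl).contDiffOn zero_le_one
  have hd : ∀ t : ℝ, deriv (fun t : ℝ => v (y + t • (x - y))) t =
      fderiv ℝ v (y + t • (x - y)) (x - y) := fun t => by
    have h2 : HasDerivAt (fun t : ℝ => y + t • (x - y)) (x - y) t := by
      simpa using ((hasDerivAt_id t).smul_const (x - y)).const_add y
    exact (((hv.differentiable one_ne_zero _).hasFDerivAt).comp_hasDerivAt t h2).deriv
  have hc : Continuous fun t : ℝ => ‖fderiv ℝ v (y + t • (x - y))‖ₑ :=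
    ((hv.continuous_fderiv one_ne_zero).comp hl.continuous).enorm
  simp only [one_smul, add_sub_cancel, zero_smul, add_zero, hd] at h1
  have h3 : ‖v x - v y‖ₑ ≤ ‖x - y‖ₑ *
      ∫⁻ t in Icc (0 : ℝ) 1, ‖fderiv ℝ v (y + t • (x - y))‖ₑ := by
    rw [← lintegral_const_mul _ hc.measurable]
    refine h1.trans (lintegral_mono fun t => ?_)
    rw [mul_comm]
    exact ContinuousLinearMap.le_opENorm _ _
  have : IsProbabilityMeasure (volume.restrict (Icc (0 : ℝ) 1)) := ⟨by simp⟩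
  calc ‖v x - v y‖ₑ ^ q ≤ _ := ENNReal.rpow_le_rpow h3 (zero_le_one.trans hq)
    _ = _ := ENNReal.mul_rpow_of_nonneg _ _ (zero_le_one.trans hq)
    _ ≤ _ := by
      gcongr
      exact lintegral_rpow_le_of_isProbabilityMeasure hc.measurable.aemeasurable hq

theorem lintegral_comp_add_smul (f : Rn n → ℝ≥0∞) (a : Rn n) {t : ℝ} (ht : 0 < t) :
    ∫⁻ y, f (a + t • y) = ENNReal.ofReal ((t ^ n)⁻¹) * ∫⁻ y, f y := by
  have h1 : ∫⁻ y, f (a + t • y) = ∫⁻ y, f (a + y) ∂(volume.map (fun y : Rn n => t • y)) :=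
    ((Homeomorph.smulOfNeZero t ht.ne').measurableEmbedding.lintegral_map
      (fun y => f (a + y))).symm
  rw [h1, Measure.map_addHaar_smul _ ht.ne', lintegral_smul_measure,
    lintegral_add_left_eq_self, finrank_euclideanSpace_fin, abs_of_pos (by positivity), smul_eq_mul]

/-- The contraction towards `x` with ratio `t` maps the convex set `B` into itself, and its inverse
has Jacobian `t⁻ⁿ ≤ 2ⁿ`. -/
theorem setLIntegral_segment_le {B : Set (Rn n)} (hB : MeasurableSet B) (hc : Convex ℝ B)
    (F : Rn n → ℝ≥0∞) {x : Rn n} (hx : x ∈ B) {t : ℝ} (ht : t ∈ Icc (1 / 2 : ℝ) 1) :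
    ∫⁻ y in B, F (x + t • (y - x)) ≤ 2 ^ n * ∫⁻ y in B, F y := by
  have ht0 : 0 < t := by linarith [ht.1]
  calc ∫⁻ y in B, F (x + t • (y - x))
      ≤ ∫⁻ y, B.indicator F ((1 - t) • x + t • y) := by
        rw [← lintegral_indicator hB]
        refine lintegral_mono fun y => ?_
        by_cases hy : y ∈ B
        · have : (1 - t) • x + t • y ∈ B :=
            hc hx hy (by linarith [ht.2]) ht0.le (by ring)
          rw [indicator_of_mem hy, indicator_of_mem this]
          refine le_of_eq (congrArg F ?_)
          module
        · simp [hy]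
    _ = ENNReal.ofReal ((t ^ n)⁻¹) * ∫⁻ y in B, F y := by
        rw [lintegral_comp_add_smul _ _ ht0, lintegral_indicator hB]
    _ ≤ _ := by
        gcongr
        rw [show (2 : ℝ≥0∞) ^ n = ENNReal.ofReal (2 ^ n) by
          rw [ENNReal.ofReal_pow (by norm_num)]; simp]
        refine ENNReal.ofReal_le_ofReal ?_
        rw [← inv_pow]
        refine pow_le_pow_left₀ (by positivity) ?_ n
        rw [inv_le_comm₀ ht0 two_pos]
        linarith [ht.1]

/-- Integrate the segment estimate over `B × B`. At parameter `t`, change variables in whichever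
endpoint has weight at least `1 / 2`, so that the Jacobian stays bounded by `2ⁿ`. -/
theorem OscControl.of_convex {q : ℝ} (hq : 1 ≤ q) {B U : Set (Rn n)} (hB : MeasurableSet B)
    (hc : Convex ℝ B) (hb : Bornology.IsBounded B) (hBU : B ⊆ U) : OscControl q U B B := by
  obtain ⟨d, hd⟩ := Metric.isBounded_iff.1 hb
  have hq0 := zero_le_one.trans hq
  have hvol : volume B ≠ ⊤ := hb.measure_lt_top.ne
  refine ⟨ENNReal.ofReal d ^ q * (2 ^ n * volume B), ENNReal.mul_ne_top
    (ENNReal.rpow_ne_top_of_nonneg hq0 ENNReal.ofReal_ne_top)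
    (ENNReal.mul_ne_top (by simp) hvol), fun v hv => ?_⟩
  set F : Rn n → ℝ≥0∞ := fun x => ‖fderiv ℝ v x‖ₑ ^ q with hF
  have hFm : Measurable F :=
    (hv.continuous_fderiv one_ne_zero).enorm.measurable.pow_const q
  have hm3 : Measurable fun z : (Rn n × Rn n) × ℝ => F (z.1.2 + z.2 • (z.1.1 - z.1.2)) :=
    hFm.comp (by fun_prop : Continuous fun z : (Rn n × Rn n) × ℝ =>
      z.1.2 + z.2 • (z.1.1 - z.1.2)).measurable
  have slice : ∀ t ∈ Icc (0 : ℝ) 1, ∫⁻ x in B, ∫⁻ y in B, F (y + t • (x - y)) ≤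
      2 ^ n * volume B * ∫⁻ y in B, F y := by
    intro t ht
    have fin : ∀ G : Rn n → ℝ≥0∞, (∀ x ∈ B, G x ≤ 2 ^ n * ∫⁻ y in B, F y) →
        ∫⁻ x in B, G x ≤ 2 ^ n * volume B * ∫⁻ y in B, F y := fun G hG => by
      refine (setLIntegral_mono' hB hG).trans (le_of_eq ?_)
      rw [setLIntegral_const]; ring
    rcases le_total (1 / 2) t with h | h
    · rw [lintegral_lintegral_swap (f := fun x y => F (y + t • (x - y)))
        (hm3.comp (f := fun z : Rn n × Rn n => (z, t)) (by fun_prop)).aemeasurable]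
      exact fin _ fun y hy => setLIntegral_segment_le hB hc F hy ⟨h, ht.2⟩
    · refine fin _ fun x hx => ?_
      refine le_trans (le_of_eq ?_) (setLIntegral_segment_le hB hc F hx (t := 1 - t)
        ⟨by linarith, by linarith [ht.1]⟩)
      refine lintegral_congr fun y => congrArg F ?_
      module
  calc pairOsc q v B B
      ≤ ∫⁻ x in B, ∫⁻ y in B, ENNReal.ofReal d ^ q *
          ∫⁻ t in Icc (0 : ℝ) 1, F (y + t • (x - y)) := by
        refine setLIntegral_mono' hB fun x hx => setLIntegral_mono' hB fun y hy => ?_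
        refine (enorm_sub_rpow_le_lintegral_segment hv hq x y).trans ?_
        gcongr
        rw [← ofReal_norm, ← dist_eq_norm]
        exact ENNReal.ofReal_le_ofReal (hd hx hy)
    _ = ENNReal.ofReal d ^ q * ∫⁻ x in B, ∫⁻ y in B,
          ∫⁻ t in Icc (0 : ℝ) 1, F (y + t • (x - y)) := by
        have hT : ENNReal.ofReal d ^ q ≠ ⊤ :=
          ENNReal.rpow_ne_top_of_nonneg hq0 ENNReal.ofReal_ne_top
        rw [← lintegral_const_mul' _ _ hT]
        refine lintegral_congr fun x => ?_
        rw [lintegral_const_mul' _ _ hT]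
    _ = ENNReal.ofReal d ^ q * ∫⁻ t in Icc (0 : ℝ) 1, ∫⁻ x in B, ∫⁻ y in B,
          F (y + t • (x - y)) := by
        congr 1
        have hm4 : Measurable fun z : Rn n × ℝ => ∫⁻ y in B, F (y + z.2 • (z.1 - y)) :=
          (hm3.comp (f := fun z : (Rn n × ℝ) × Rn n => ((z.1.1, z.2), z.1.2))
            (by fun_prop)).lintegral_prod_right'
        refine Eq.trans (lintegral_congr fun x => lintegral_lintegral_swap ?_)
          (lintegral_lintegral_swap (f := fun x t => ∫⁻ y in B, F (y + t • (x - y)))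
            hm4.aemeasurable)
        exact (hm3.comp (f := fun z : Rn n × ℝ => ((x, z.1), z.2)) (by fun_prop)).aemeasurable
    _ ≤ ENNReal.ofReal d ^ q * ∫⁻ t in Icc (0 : ℝ) 1, 2 ^ n * volume B * ∫⁻ y in B, F y := by
        refine mul_le_mul_right ?_ _
        exact setLIntegral_mono' measurableSet_Icc slice
    _ = ENNReal.ofReal d ^ q * (2 ^ n * volume B) * ∫⁻ y in B, F y := by
        rw [setLIntegral_const]; simp [mul_assoc]
    _ ≤ _ := by
        gcongr

/-- Local control near a pair of points holds when both lie in one ball inside `U`, and it is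
transitive, so connectedness spreads it to all pairs in `U`. Compactness, used once in each
variable, makes it global on `K`. -/
theorem OscControl.of_isCompact {q : ℝ} (hq : 1 ≤ q) {K U : Set (Rn n)} (hU : IsOpen U)
    (hUc : IsPreconnected U) (hK : IsCompact K) (hKU : K ⊆ U) : OscControl q U K K := by
  let P : Rn n → Rn n → Prop := fun x y => ∃ S ∈ 𝓝 x, ∃ T ∈ 𝓝 y,
    volume S ≠ ⊤ ∧ volume T ≠ ⊤ ∧ OscControl q U S T
  have hP : ∀ x ∈ U, ∀ y ∈ U, P x y := fun x hx y hy => by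
    refine hUc.induction₂' P (fun x hx => ?_) (fun x y z _ _ _ => ?_) hx hy
    · obtain ⟨r, hr, hrU⟩ := Metric.isOpen_iff.1 hU x hx
      have hB := OscControl.of_convex hq (measurableSet_ball (x := x) (ε := r))
        (convex_ball x r) Metric.isBounded_ball hrU
      have hfin : volume (Metric.ball x r) ≠ ⊤ := Metric.isBounded_ball.measure_lt_top.ne
      refine mem_nhdsWithin_of_mem_nhds ?_
      filter_upwards [Metric.isOpen_ball.mem_nhds (Metric.mem_ball_self hr)] with y hy
      have h1 := Metric.isOpen_ball.mem_nhds (Metric.mem_ball_self (x := x) hr)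
      have h2 := Metric.isOpen_ball.mem_nhds hy
      exact ⟨⟨_, h1, _, h2, hfin, hfin, hB⟩, ⟨_, h2, _, h1, hfin, hfin, hB⟩⟩
    · rintro ⟨S, hS, W, hW, hSf, hWf, h⟩ ⟨W', hW', T, hT, -, hTf, h'⟩
      -- `W ∩ W'` is a neighbourhood of the middle point, so it has positive measure, as the
      -- averaging in `OscControl.trans` requires.
      exact ⟨S, hS, T, hT, hSf, hTf, OscControl.trans hq (W := W ∩ W')
        (h.mono subset_rfl inter_subset_left) (h'.mono inter_subset_right subset_rfl)
        (Measure.measure_pos_of_mem_nhds _ (inter_mem hW hW')).ne'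
        (measure_ne_top_of_subset inter_subset_left hWf) hSf hTf⟩
  have h0 : ∀ T, OscControl q U ∅ T := fun T => ⟨0, by simp, fun v _ => by simp [pairOsc]⟩
  have h1 : ∀ y ∈ K, ∃ T ∈ 𝓝 y, OscControl q U K T := fun y hy => by
    refine hK.induction_on (p := fun S => ∃ T ∈ 𝓝 y, OscControl q U S T)
      ⟨univ, univ_mem, h0 _⟩ ?_ ?_ ?_
    · rintro S S' hSS ⟨T, hT, h⟩
      exact ⟨T, hT, h.mono hSS subset_rfl⟩
    · rintro S S' ⟨T, hT, h⟩ ⟨T', hT', h'⟩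
      exact ⟨T ∩ T', inter_mem hT hT', (h.mono subset_rfl inter_subset_left).union_left
        (h'.mono subset_rfl inter_subset_right)⟩
    · intro x hx
      obtain ⟨S, hS, T, hT, -, -, h⟩ := hP x (hKU hx) y (hKU hy)
      exact ⟨S, mem_nhdsWithin_of_mem_nhds hS, T, hT, h⟩
  refine hK.induction_on (p := fun T => OscControl q U T K) (h0 K)
    (fun S T hST h => h.mono hST subset_rfl) (fun S T h h' => h.union_left h') fun y hy => ?_
  obtain ⟨T, hT, h⟩ := h1 y hy
  exact ⟨T, mem_nhdsWithin_of_mem_nhds hT, h.symm⟩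

end Poincare

/-! ### The Poincaré inequality on annuli, uniformly in the scale. -/

section AnnulusPoincare

/-- Mollifiers with radii tending to zero. -/
noncomputable def bumpSeq (n k : ℕ) : ContDiffBump (0 : Rn n) where
  rIn := 1 / 2 * (1 / ((k : ℝ) + 1))
  rOut := 1 / ((k : ℝ) + 1)
  rIn_pos := by positivity
  rIn_lt_rOut := by
    have : 0 < 1 / ((k : ℝ) + 1) := by positivity
    linarith

theorem tendsto_bumpSeq_rOut (n : ℕ) : Tendsto (fun k => (bumpSeq n k).rOut) atTop (𝓝 0) :=
  tendsto_one_div_add_atTop_nhds_zero_nat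

theorem tendsto_mollify_of_continuous {u : Rn n → ℝ} (hu : Continuous u) (x : Rn n) :
    Tendsto (fun k => mollify (bumpSeq n k) u x) atTop (𝓝 (u x)) :=
  ContDiffBump.convolution_tendsto_right_of_continuous (tendsto_bumpSeq_rOut n) hu x

theorem ae_tendsto_mollify {F : Type*} [NormedAddCommGroup F] [NormedSpace ℝ F] [CompleteSpace F]
    {f : Rn n → F} (hf : LocallyIntegrable f volume) :
    ∀ᵐ x, Tendsto (fun k => mollify (bumpSeq n k) f x) atTop (𝓝 (f x)) :=
  ContDiffBump.ae_convolution_tendsto_right_of_locallyIntegrable (K := 2)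
    (tendsto_bumpSeq_rOut n) (Eventually.of_forall fun k => by simp [bumpSeq]) hf

theorem enorm_fderiv_mollify {u : Rn n → ℝ} {g : Rn n → Rn n} (h : IsWeakGradient u g)
    (φ : ContDiffBump (0 : Rn n)) (x : Rn n) :
    ‖fderiv ℝ (mollify φ u) x‖ₑ = ‖mollify φ g x‖ₑ := by
  rw [(hasGradientAt_iff_hasFDerivAt.1 (hasGradientAt_mollify φ h x)).fderiv,
    LinearIsometryEquiv.enorm_map]

/-- Polar coordinates exhibit the annulus as the continuous image of an interval times the unit
sphere, which is connected because `2 ≤ n`. -/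
theorem isPreconnected_annulus (hn : 2 ≤ n) {a : ℝ} (ha : 0 ≤ a) (b : ℝ) :
    IsPreconnected {x : Rn n | a < ‖x‖ ∧ ‖x‖ < b} := by
  have hs : IsPreconnected (Metric.sphere (0 : Rn n) 1) := by
    refine isPreconnected_sphere ?_ _ _
    rw [← Module.finrank_eq_rank, finrank_euclideanSpace_fin]
    exact_mod_cast hn
  have h := ((isPreconnected_Ioo (a := a) (b := b)).prod hs).image (fun z : ℝ × Rn n => z.1 • z.2)
    (by fun_prop)
  convert h using 1
  ext x
  simp only [mem_ofPred_eq, mem_image, mem_prod, mem_Ioo, mem_sphere_zero_iff_norm, Prod.exists]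
  constructor
  · rintro ⟨h1, h2⟩
    have : ‖x‖ ≠ 0 := (ha.trans_lt h1).ne'
    exact ⟨‖x‖, ‖x‖⁻¹ • x, ⟨⟨h1, h2⟩, by rw [norm_smul, norm_inv, norm_norm, inv_mul_cancel₀ this]⟩,
      by rw [smul_inv_smul₀ this]⟩
  · rintro ⟨r, y, ⟨⟨h1, h2⟩, hy⟩, rfl⟩
    rw [norm_smul, hy, mul_one, Real.norm_of_nonneg (ha.trans h1.le)]
    exact ⟨h1, h2⟩

/-- The set `x₀ + R • S`. -/
def scaledSet (x₀ : Rn n) (R : ℝ) (S : Set (Rn n)) : Set (Rn n) :=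
  (fun x => R⁻¹ • (x - x₀)) ⁻¹' S

theorem measurableSet_scaledSet (x₀ : Rn n) (R : ℝ) {S : Set (Rn n)} (hS : MeasurableSet S) :
    MeasurableSet (scaledSet x₀ R S) :=
  hS.preimage (by fun_prop)

theorem setLIntegral_scaledSet (x₀ : Rn n) {R : ℝ} (hR : 0 < R) {S : Set (Rn n)}
    (hS : MeasurableSet S) (f : Rn n → ℝ≥0∞) :
    ∫⁻ y in S, f (x₀ + R • y) = ENNReal.ofReal ((R ^ n)⁻¹) * ∫⁻ x in scaledSet x₀ R S, f x := by
  rw [← lintegral_indicator (measurableSet_scaledSet x₀ R hS), ← lintegral_comp_add_smul _ x₀ hR,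
    ← lintegral_indicator hS]
  refine lintegral_congr fun y => ?_
  have : x₀ + R • y ∈ scaledSet x₀ R S ↔ y ∈ S := by
    simp [scaledSet, smul_smul, inv_mul_cancel₀ hR.ne']
  by_cases hy : y ∈ S
  · rw [indicator_of_mem hy, indicator_of_mem (this.2 hy)]
  · rw [indicator_of_notMem hy, indicator_of_notMem (mt this.1 hy)]

/-- Apply the estimate to `y ↦ v (x₀ + R y)`. The double integral scales by `R⁻²ⁿ`, the energy by
`R^q R⁻ⁿ`; the quotient leaves the factor `R^q Rⁿ`. -/
theorem pairOsc_scaledSet_le {q : ℝ} (hq : 1 ≤ q) {U K : Set (Rn n)} (hU : MeasurableSet U)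
    (hK : MeasurableSet K) {C : ℝ≥0∞}
    (hC : ∀ v : Rn n → ℝ, ContDiff ℝ 1 v →
      pairOsc q v K K ≤ C * ∫⁻ x in U, ‖fderiv ℝ v x‖ₑ ^ q)
    {v : Rn n → ℝ} (hv : ContDiff ℝ 1 v) (x₀ : Rn n) {R : ℝ} (hR : 0 < R) :
    pairOsc q v (scaledSet x₀ R K) (scaledSet x₀ R K) ≤
      C * (ENNReal.ofReal R ^ q * ENNReal.ofReal (R ^ n) *
        ∫⁻ x in scaledSet x₀ R U, ‖fderiv ℝ v x‖ₑ ^ q) := by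
  have hl : ContDiff ℝ 1 fun y : Rn n => x₀ + R • y := by fun_prop
  have h := hC _ (hv.comp hl)
  have hd : ∀ y : Rn n, ‖fderiv ℝ (v ∘ fun y : Rn n => x₀ + R • y) y‖ₑ ^ q =
      ENNReal.ofReal R ^ q * ‖fderiv ℝ v (x₀ + R • y)‖ₑ ^ q := fun y => by
    have h1 : HasFDerivAt (fun y : Rn n => x₀ + R • y) (R • ContinuousLinearMap.id ℝ (Rn n)) y :=
      ((hasFDerivAt_id y).const_smul R).const_add x₀
    rw [((hv.differentiable one_ne_zero _).hasFDerivAt.comp y h1).fderiv,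
      ContinuousLinearMap.comp_smul, ContinuousLinearMap.comp_id, enorm_smul,
      Real.enorm_of_nonneg hR.le, ENNReal.mul_rpow_of_nonneg _ _ (zero_le_one.trans hq)]
  set c := ENNReal.ofReal ((R ^ n)⁻¹) with hc
  have hc0 : c ≠ 0 := by simpa [hc] using pow_pos hR n
  have hct : c ≠ ⊤ := ENNReal.ofReal_ne_top
  have hci : ENNReal.ofReal (R ^ n) = c⁻¹ := by
    rw [hc, ENNReal.ofReal_inv_of_pos (pow_pos hR n), inv_inv]
  have hRq : ENNReal.ofReal R ^ q ≠ ⊤ :=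
    ENNReal.rpow_ne_top_of_nonneg (zero_le_one.trans hq) ENNReal.ofReal_ne_top
  simp only [hd] at h
  rw [lintegral_const_mul' _ _ hRq,
    setLIntegral_scaledSet x₀ hR hU (fun x => ‖fderiv ℝ v x‖ₑ ^ q)] at h
  have hP : pairOsc q (v ∘ fun y : Rn n => x₀ + R • y) K K =
      c * (c * pairOsc q v (scaledSet x₀ R K) (scaledSet x₀ R K)) := by
    simp only [pairOsc, Function.comp_apply]
    have : ∀ x : Rn n, ∫⁻ y in K, ‖v x - v (x₀ + R • y)‖ₑ ^ q =
        c * ∫⁻ y in scaledSet x₀ R K, ‖v x - v y‖ₑ ^ q := fun x =>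
      setLIntegral_scaledSet x₀ hR hK fun y => ‖v x - v y‖ₑ ^ q
    simp only [this]
    rw [lintegral_const_mul' _ _ hct, setLIntegral_scaledSet x₀ hR hK
      fun x => ∫⁻ y in scaledSet x₀ R K, ‖v x - v y‖ₑ ^ q]
  rw [hP] at h
  have h2 : c * pairOsc q v (scaledSet x₀ R K) (scaledSet x₀ R K) ≤
      C * (ENNReal.ofReal R ^ q * ∫⁻ x in scaledSet x₀ R U, ‖fderiv ℝ v x‖ₑ ^ q) := by
    refine (ENNReal.mul_le_mul_iff_right hc0 hct).1 (h.trans (le_of_eq ?_))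
    ring
  rw [hci]
  calc _ = c⁻¹ * (c * pairOsc q v (scaledSet x₀ R K) (scaledSet x₀ R K)) := by
        rw [← mul_assoc, ENNReal.inv_mul_cancel hc0 hct, one_mul]
    _ ≤ c⁻¹ * (C * (ENNReal.ofReal R ^ q * ∫⁻ x in scaledSet x₀ R U, ‖fderiv ℝ v x‖ₑ ^ q)) := by
        gcongr
    _ = _ := by ring

/-- Fatou's lemma, once in each variable. -/
theorem pairOsc_le_of_tendsto {q : ℝ} {v : ℕ → Rn n → ℝ} (hv : ∀ k, Continuous (v k))
    {u : Rn n → ℝ} (h : ∀ x, Tendsto (fun k => v k x) atTop (𝓝 (u x))) {S T : Set (Rn n)}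
    {M : ℝ≥0∞} (hM : ∀ᶠ k in atTop, pairOsc q (v k) S T ≤ M) : pairOsc q u S T ≤ M := by
  have hm := fun k => measurable_enorm_sub_rpow (hv k) q
  calc pairOsc q u S T
      = ∫⁻ x in S, ∫⁻ y in T, liminf (fun k => ‖v k x - v k y‖ₑ ^ q) atTop := by
        refine lintegral_congr fun x => lintegral_congr fun y => ?_
        exact ((((h x).sub (h y)).enorm.ennrpow_const q).liminf_eq).symm
    _ ≤ ∫⁻ x in S, liminf (fun k => ∫⁻ y in T, ‖v k x - v k y‖ₑ ^ q) atTop :=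
        lintegral_mono fun x => lintegral_liminf_le fun k => (hm k).comp measurable_prodMk_left
    _ ≤ liminf (fun k => pairOsc q (v k) S T) atTop :=
        lintegral_liminf_le fun k => (hm k).lintegral_prod_right'
    _ ≤ M := liminf_le_of_frequently_le' hM.frequently

/-- The closed annulus on which the oscillation is estimated. -/
def innerAnnulus (n : ℕ) : Set (Rn n) := {x | 5 / 4 ≤ ‖x‖ ∧ ‖x‖ ≤ 7 / 4}

/-- The open annulus with radii `1` and `2`. -/
def unitAnnulus (n : ℕ) : Set (Rn n) := {x | 1 < ‖x‖ ∧ ‖x‖ < 2}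

theorem measurableSet_innerAnnulus (n : ℕ) : MeasurableSet (innerAnnulus n) :=
  (isClosed_le continuous_const continuous_norm).inter
    (isClosed_le continuous_norm continuous_const) |>.measurableSet

theorem measurableSet_unitAnnulus (n : ℕ) : MeasurableSet (unitAnnulus n) :=
  (isOpen_lt continuous_const continuous_norm).inter
    (isOpen_lt continuous_norm continuous_const) |>.measurableSet

theorem volume_innerAnnulus_pos (hn : 2 ≤ n) : volume (innerAnnulus n) ≠ 0 := by
  have : Nonempty (Fin n) := ⟨⟨0, by omega⟩⟩
  obtain ⟨x, hx⟩ := exists_norm_eq (Rn n) (show (0 : ℝ) ≤ 3 / 2 by norm_num)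
  refine (Measure.measure_pos_of_mem_nhds (x := x) _ ?_).ne'
  filter_upwards [continuous_norm.continuousAt.eventually
    (Icc_mem_nhds (show 5 / 4 < ‖x‖ by rw [hx]; norm_num) (show ‖x‖ < 7 / 4 by rw [hx]; norm_num))]
    with y hy using hy

/-- A Poincaré inequality for weakly differentiable functions on annuli, with a scale invariant
constant. -/
theorem exists_poincare_annulus (hn : 2 ≤ n) {q : ℝ} (hq : 1 ≤ q) :
    ∃ C : ℝ≥0∞, C ≠ ⊤ ∧ ∀ (u : Rn n → ℝ) (g : Rn n → Rn n), Continuous u → IsWeakGradient u g →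
      ∀ (x₀ : Rn n) (R : ℝ), 0 < R → ∃ c : ℝ,
        ∫⁻ x in scaledSet x₀ R (innerAnnulus n), ‖u x - c‖ₑ ^ q ≤
          C * (ENNReal.ofReal R ^ q * ∫⁻ x in scaledSet x₀ R (unitAnnulus n), ‖g x‖ₑ ^ q) := by
  set K := innerAnnulus n with hKdef
  -- An annulus strictly between the inner and the unit one. The gap `1 / 8` on each side of the
  -- unit annulus leaves room for mollifiers of radius less than `R / 8`.
  set U : Set (Rn n) := {x | 9 / 8 < ‖x‖ ∧ ‖x‖ < 15 / 8} with hUdef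
  have hUo : IsOpen U := (isOpen_lt continuous_const continuous_norm).inter
    (isOpen_lt continuous_norm continuous_const)
  have hKb : K ⊆ Metric.closedBall 0 (7 / 4) := fun x hx => by simpa using hx.2
  have hKc : IsCompact K := (isCompact_closedBall (0 : Rn n) (7 / 4)).of_isClosed_subset
    ((isClosed_le continuous_const continuous_norm).inter
      (isClosed_le continuous_norm continuous_const)) hKb
  obtain ⟨C, hC, H⟩ := OscControl.of_isCompact hq hUo
    (isPreconnected_annulus hn (by norm_num) _) hKc
    (fun x hx => ⟨by linarith [hx.1], by linarith [hx.2]⟩)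
  have hK0 := volume_innerAnnulus_pos hn
  have hKt : volume K ≠ ⊤ := hKc.measure_lt_top.ne
  have hKm := measurableSet_innerAnnulus n
  refine ⟨(volume K)⁻¹ * C, ENNReal.mul_ne_top (ENNReal.inv_ne_top.2 hK0) hC,
    fun u g hu hg x₀ R hR => ?_⟩
  set V := scaledSet x₀ R (unitAnnulus n)
  set KR := scaledSet x₀ R K
  have hgm : AEStronglyMeasurable g volume := hg.locallyIntegrable_grad.aestronglyMeasurable
  have hPo : pairOsc q u KR KR ≤
      C * (ENNReal.ofReal R ^ q * ENNReal.ofReal (R ^ n) * ∫⁻ x in V, ‖g x‖ₑ ^ q) := by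
    refine pairOsc_le_of_tendsto
      (fun k => (contDiff_mollify (bumpSeq n k) hg.locallyIntegrable).continuous)
      (tendsto_mollify_of_continuous hu) ?_
    filter_upwards [(tendsto_bumpSeq_rOut n).eventually_lt_const (show 0 < R / 8 by positivity)]
      with k hk
    refine (pairOsc_scaledSet_le hq hUo.measurableSet hKm H
      ((contDiff_mollify (bumpSeq n k) hg.locallyIntegrable).of_le (by simp)) x₀ hR).trans ?_
    refine mul_le_mul_right (mul_le_mul_right ?_ _) _
    simp only [enorm_fderiv_mollify hg]
    refine setLIntegral_enorm_mollify_rpow_le _ hgm hq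
      (measurableSet_scaledSet _ _ hUo.measurableSet)
      (measurableSet_scaledSet _ _ (measurableSet_unitAnnulus n)) fun x hx y hy => ?_
    have h1 : ‖R⁻¹ • (y - x₀) - R⁻¹ • (x - x₀)‖ < 1 / 8 := by
      rw [← smul_sub, sub_sub_sub_cancel_right, norm_smul, norm_inv, Real.norm_of_nonneg hR.le,
        inv_mul_lt_iff₀ hR]
      rw [Metric.mem_ball, dist_eq_norm] at hy
      linarith
    have h2 := abs_lt.1 ((abs_norm_sub_norm_le _ _).trans_lt h1)
    have hx' : 9 / 8 < ‖R⁻¹ • (x - x₀)‖ ∧ ‖R⁻¹ • (x - x₀)‖ < 15 / 8 := hx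
    exact ⟨by linarith [h2.1, hx'.1], by linarith [h2.2, hx'.2]⟩
  have hKRm : MeasurableSet KR := measurableSet_scaledSet x₀ R hKm
  have hvol : volume K = ENNReal.ofReal ((R ^ n)⁻¹) * volume KR := by
    simpa using setLIntegral_scaledSet x₀ hR hKm (fun _ => 1)
  have hc0 : ENNReal.ofReal ((R ^ n)⁻¹) ≠ 0 := by simpa using pow_pos hR n
  have hvol' : volume KR = ENNReal.ofReal (R ^ n) * volume K := by
    rw [hvol, ← mul_assoc, ← ENNReal.ofReal_mul (by positivity),
      mul_inv_cancel₀ (pow_pos hR n).ne', ENNReal.ofReal_one, one_mul]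
  have hRn0 : ENNReal.ofReal (R ^ n) ≠ 0 := by simpa using pow_pos hR n
  have hKR0 : volume KR ≠ 0 := by
    rw [hvol']
    exact mul_ne_zero hRn0 hK0
  have hKRt : volume KR ≠ ⊤ := by
    rw [hvol']; exact ENNReal.mul_ne_top ENNReal.ofReal_ne_top hKt
  -- The constant is the value of `u` at a point where the inner integral does not exceed its
  -- average. Dividing by `|KR| = Rⁿ |K|` then removes the factor `Rⁿ`.
  obtain ⟨y, -, hy⟩ := exists_le_setLAverage hKR0 hKRt
    (f := fun y => ∫⁻ x in KR, ‖u y - u x‖ₑ ^ q)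
    (measurable_enorm_sub_rpow hu q).lintegral_prod_right'.aemeasurable
  refine ⟨u y, ?_⟩
  rw [setLAverage_eq] at hy
  calc ∫⁻ x in KR, ‖u x - u y‖ₑ ^ q = ∫⁻ x in KR, ‖u y - u x‖ₑ ^ q := by
        refine lintegral_congr fun x => ?_
        rw [← enorm_neg, neg_sub]
    _ ≤ pairOsc q u KR KR / volume KR := hy
    _ ≤ (C * (ENNReal.ofReal R ^ q * ENNReal.ofReal (R ^ n) * ∫⁻ x in V, ‖g x‖ₑ ^ q)) /
          volume KR := by gcongr
    _ = ENNReal.ofReal (R ^ n) * ((ENNReal.ofReal (R ^ n))⁻¹) * ((volume K)⁻¹ * C *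
          (ENNReal.ofReal R ^ q * ∫⁻ x in V, ‖g x‖ₑ ^ q)) := by
        rw [hvol', ENNReal.div_eq_inv_mul, ENNReal.mul_inv (Or.inl hRn0)
          (Or.inl ENNReal.ofReal_ne_top)]
        ring
    _ = _ := by rw [ENNReal.mul_inv_cancel hRn0 ENNReal.ofReal_ne_top, one_mul]

end AnnulusPoincare

/-! ### Log-Hölder exponents and mollification in the modular. -/

section LogHolder

theorem IsLogHolderExponent.exists_le {p : Rn n → ℝ} (hp : IsLogHolderExponent p) :
    ∃ P : ℝ, ∀ x, p x ≤ P :=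
  let ⟨P, hP⟩ := hp.bddAbove
  ⟨P, fun x => hP (mem_range_self x)⟩

theorem IsLogHolder.exists_modulus {α : Rn n → ℝ} (h : IsLogHolder α) :
    ∃ L : ℝ, 0 < L ∧ ∀ r > 0, ∀ x y : Rn n, ‖x - y‖ ≤ r →
      |α x - α y| ≤ L / Real.log (Real.exp 1 + 1 / r) := by
  obtain ⟨L, hL, H⟩ := h
  refine ⟨L, hL, fun r hr x y hxy => ?_⟩
  have hlog : ∀ t > 0, 1 ≤ Real.log (Real.exp 1 + 1 / t) := fun t ht => by
    rw [Real.le_log_iff_exp_le (by positivity)]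
    have : 0 < 1 / t := by positivity
    linarith
  -- Monotonicity of the modulus fails at `x = y`, where `1 / 0 = 0` gives the value `L`; there the
  -- left-hand side is zero.
  rcases (norm_nonneg (x - y)).eq_or_lt with h0 | h0
  · have : x = y := by rw [← sub_eq_zero, ← norm_eq_zero, ← h0]
    have := hlog r hr
    simp only [‹x = y›, sub_self, abs_zero]
    positivity
  · refine (H x y).trans ?_
    have := hlog r hr
    gcongr

theorem tendsto_log_modulus (L : ℝ) :
    Tendsto (fun r : ℝ => L / Real.log (Real.exp 1 + 1 / r)) (𝓝[>] 0) (𝓝 0) := by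
  refine Tendsto.div_atTop tendsto_const_nhds (Real.tendsto_log_atTop.comp ?_)
  refine tendsto_atTop_add_const_left _ _ ?_
  exact (tendsto_inv_nhdsGT_zero (𝕜 := ℝ)).congr fun x => (one_div x).symm

theorem IsLogHolder.continuous {α : Rn n → ℝ} (h : IsLogHolder α) : Continuous α := by
  obtain ⟨L, hL, H⟩ := h.exists_modulus
  rw [Metric.continuous_iff]
  intro y ε hε
  obtain ⟨r, hr, hr0⟩ := (((tendsto_log_modulus L).eventually_lt_const hε).and
    self_mem_nhdsWithin).exists
  exact ⟨r, hr0, fun x hx => (H r hr0 x y (by rw [← dist_eq_norm]; exact hx.le)).trans_lt hr⟩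

theorem IsLogHolderExponent.continuous {p : Rn n → ℝ} (hp : IsLogHolderExponent p) :
    Continuous p := by
  have h := hp.logHolder.continuous.inv₀ fun x => by
    have := hp.one_le x
    positivity
  exact h.congr fun x => by simp

theorem rpow_le_one_add_rpow {a : ℝ≥0∞} {s t : ℝ} (hs : 0 ≤ s) (hst : s ≤ t) :
    a ^ s ≤ 1 + a ^ t := by
  rcases le_total a 1 with h | h
  · exact (ENNReal.rpow_le_one h hs).trans le_self_add
  · exact (ENNReal.rpow_le_rpow_of_exponent_le h hst).trans le_add_self

theorem mollify_nonneg (φ : ContDiffBump (0 : Rn n)) {h : Rn n → ℝ} (hh : ∀ x, 0 ≤ h x)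
    (x : Rn n) : 0 ≤ mollify φ h x := by
  rw [mollify_apply]
  exact integral_nonneg fun t => hh _

theorem integrable_comp_sub_bumpMeasure (φ : ContDiffBump (0 : Rn n)) {F : Type*}
    [NormedAddCommGroup F] {h : Rn n → F} (hh : Integrable h volume) (x : Rn n) :
    Integrable (fun t => h (x - t)) (bumpMeasure φ) := by
  refine ⟨aestronglyMeasurable_comp_sub_bumpMeasure φ hh.aestronglyMeasurable x, ?_⟩
  rw [hasFiniteIntegral_iff_enorm, lintegral_bumpMeasure]
  refine (lintegral_mono fun t => mul_le_mul_left (ENNReal.ofReal_le_ofReal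
    (φ.normed_le_div_measure_closedBall_rIn volume t)) _).trans_lt ?_
  rw [lintegral_const_mul' _ _ ENNReal.ofReal_ne_top]
  exact ENNReal.mul_lt_top ENNReal.ofReal_lt_top (hh.comp_sub_left x).2

theorem ofReal_mollify (φ : ContDiffBump (0 : Rn n)) {h : Rn n → ℝ} (hh : Integrable h volume)
    (h0 : ∀ x, 0 ≤ h x) (x : Rn n) :
    ENNReal.ofReal (mollify φ h x) = ∫⁻ t, ENNReal.ofReal (h (x - t)) ∂bumpMeasure φ := by
  rw [mollify_apply, ofReal_integral_eq_lintegral_ofReal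
    (integrable_comp_sub_bumpMeasure φ hh x) (Eventually.of_forall fun t => h0 _)]

theorem mollify_le (φ : ContDiffBump (0 : Rn n)) {h : Rn n → ℝ} (hh : Integrable h volume)
    (h0 : ∀ x, 0 ≤ h x) (x : Rn n) :
    mollify φ h x ≤ 1 / volume.real (Metric.closedBall (0 : Rn n) φ.rIn) * ∫ y, h y := by
  rw [← integral_sub_left_eq_self h volume x, ← integral_const_mul]
  have e : mollify φ h x = ∫ t, φ.normed volume t * h (x - t) := rfl
  rw [e]
  refine integral_mono_of_nonneg
    (Eventually.of_forall fun t => mul_nonneg (φ.nonneg_normed _) (h0 _))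
    ((hh.comp_sub_left x).const_mul _) (Eventually.of_forall fun t => ?_)
  exact mul_le_mul_of_nonneg_right (φ.normed_le_div_measure_closedBall_rIn volume t) (h0 _)

theorem enorm_rpow_eq_ofReal {F : Type*} [NormedAddCommGroup F] (z : F) {s : ℝ} (hs : 0 ≤ s) :
    ‖z‖ₑ ^ s = ENNReal.ofReal (‖z‖ ^ s) := by
  rw [← ofReal_norm, ENNReal.ofReal_rpow_of_nonneg (norm_nonneg _) hs]

/-- Mollification is controlled in the modular of a log-Hölder exponent: the pointwise form of
Jensen's inequality with a variable exponent. -/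
theorem exists_norm_mollify_rpow_le {p : Rn n → ℝ} (hp : IsLogHolderExponent p)
    {F : Type*} [NormedAddCommGroup F] [NormedSpace ℝ F] {f : Rn n → F}
    (hf : AEStronglyMeasurable f volume) (hfp : Integrable (fun x => ‖f x‖ ^ p x) volume) :
    ∃ C : ℝ, 0 ≤ C ∧ ∀ k x, ‖mollify (bumpSeq n k) f x‖ ^ p x ≤
      C * (1 + mollify (bumpSeq n k) (fun x => ‖f x‖ ^ p x) x) := by
  obtain ⟨P, hP⟩ := hp.exists_le
  obtain ⟨L, hL, hα⟩ := hp.logHolder.exists_modulus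
  set h : Rn n → ℝ := fun x => ‖f x‖ ^ p x with hh
  have h0 : ∀ x, 0 ≤ h x := fun x => by positivity
  set κ := volume.real (Metric.ball (0 : Rn n) 1) with hκ
  have hκ0 : 0 < κ := ENNReal.toReal_pos (Metric.measure_ball_pos _ _ one_pos).ne'
    measure_ball_lt_top.ne
  set M := ∫ y, h y with hM
  have hM0 : 0 ≤ M := integral_nonneg h0
  have hP1 : 1 ≤ P := (hp.one_le 0).trans (hP 0)
  set a := 1 + 2 ^ n / κ * M with ha
  have ha1 : 1 ≤ a := le_add_of_nonneg_right (by positivity)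
  -- This bounds `G ^ (P * δ)` below: `log G` is at most `(log a + n) ℓ` while `δ = L / ℓ`, so the
  -- logarithm `ℓ` of the inverse radius cancels. Log-Hölder continuity is exactly what makes this
  -- possible.
  refine ⟨Real.exp ((Real.log a + n) * (P * L)), by positivity, fun k x => ?_⟩
  set φ := bumpSeq n k
  set r := φ.rOut with hr
  have hr0 : 0 < r := φ.rOut_pos
  have hrin : φ.rIn = r / 2 := by simp only [hr, φ, bumpSeq]; ring
  set b := Real.exp 1 + 1 / r with hb
  have hr1 : 0 < 1 / r := by positivity
  have hb1 : 1 ≤ b := by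
    have := Real.add_one_le_exp (1 : ℝ)
    linarith
  set ℓ := Real.log b with hℓ
  have hℓ1 : 1 ≤ ℓ := by
    rw [hℓ, Real.le_log_iff_exp_le (by positivity)]
    linarith
  set δ := L / ℓ with hδ
  have hδ0 : 0 < δ := by positivity
  have hpx := hp.one_le x
  -- A lower bound for `p` on the ball of radius `r` about `x`, read off from the modulus of `1 /
  -- p`. The maximum with `1` keeps Jensen's inequality available.
  set s := max 1 (1 / (1 / p x + δ)) with hs
  have hs1 : 1 ≤ s := le_max_left _ _
  have hsp : ∀ t ∈ Metric.ball (0 : Rn n) r, s ≤ p (x - t) := fun t ht => by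
    refine max_le (hp.one_le _) ?_
    have h1 := hα r hr0 x (x - t) (by simpa using (mem_ball_zero_iff.1 ht).le)
    have h2 := (abs_le.1 h1).1
    have h3 := hp.one_le (x - t)
    rw [one_div_le (by positivity) (by positivity)]
    linarith
  have hps : p x / s ≤ 1 + P * δ := by
    have : 1 / s ≤ 1 / p x + δ := by
      rw [one_div_le (by positivity) (by positivity)]
      exact le_max_right _ _
    calc p x / s = p x * (1 / s) := by ring
      _ ≤ p x * (1 / p x + δ) := by gcongr
      _ = 1 + p x * δ := by field_simp
      _ ≤ _ := by gcongr; exact hP x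
  set G := 1 + mollify φ h x with hG
  have hG1 : 1 ≤ G := le_add_of_nonneg_right (mollify_nonneg φ h0 x)
  -- Jensen with the constant exponent `s`; raising `s` to `p (x - t)` costs only the summand `1`.
  have hjensen : ‖mollify φ f x‖ ^ s ≤ G := by
    rw [← ENNReal.ofReal_le_ofReal_iff (by positivity), ← enorm_rpow_eq_ofReal _ (by positivity)]
    calc ‖mollify φ f x‖ₑ ^ s ≤ ∫⁻ t, ‖f (x - t)‖ₑ ^ s ∂bumpMeasure φ :=
          enorm_mollify_rpow_le φ hf hs1 x
      _ ≤ ∫⁻ t, (1 + ENNReal.ofReal (h (x - t))) ∂bumpMeasure φ := by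
          refine lintegral_mono_ae ?_
          filter_upwards [ae_bumpMeasure_mem_ball φ] with t ht
          rw [hh, ← enorm_rpow_eq_ofReal _ (zero_le_one.trans (hp.one_le _))]
          exact rpow_le_one_add_rpow (by positivity) (hsp t ht)
      _ = ENNReal.ofReal G := by
          rw [lintegral_add_left measurable_const, hG,
            ENNReal.ofReal_add zero_le_one (mollify_nonneg φ h0 x), ofReal_mollify φ hfp h0]
          simp
  have hGb : G ≤ a * b ^ n := by
    have h1 := mollify_le φ hfp h0 x
    have hv : volume.real (Metric.closedBall (0 : Rn n) φ.rIn) = (r / 2) ^ n * κ := by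
      rw [hrin, Measure.real, Measure.addHaar_closedBall _ _ (by positivity),
        finrank_euclideanSpace_fin, ENNReal.toReal_mul, ENNReal.toReal_ofReal (by positivity)]
      rfl
    rw [hv] at h1
    have h2 : 1 / ((r / 2) ^ n * κ) * M = 2 ^ n / κ * M * (1 / r) ^ n := by
      rw [div_pow, div_pow, one_pow]; field_simp
    have h3 : (1 / r) ^ n ≤ b ^ n :=
      pow_le_pow_left₀ hr1.le (by linarith [Real.exp_pos 1]) n
    have h4 : 1 ≤ b ^ n := one_le_pow₀ hb1
    calc G ≤ 1 + 2 ^ n / κ * M * (1 / r) ^ n := by rw [hG, ← h2]; gcongr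
      _ ≤ b ^ n + 2 ^ n / κ * M * b ^ n := by gcongr
      _ = a * b ^ n := by ring
  have hlogG : Real.log G ≤ (Real.log a + n) * ℓ := by
    calc Real.log G ≤ Real.log (a * b ^ n) := Real.log_le_log (by positivity) hGb
      _ = Real.log a + n * ℓ := by
          rw [Real.log_mul (by positivity) (by positivity), Real.log_pow]
      _ ≤ Real.log a * ℓ + n * ℓ := by
          gcongr
          exact le_mul_of_one_le_right (Real.log_nonneg ha1) hℓ1
      _ = _ := by ring
  have hpow : G ^ (P * δ) ≤ Real.exp ((Real.log a + n) * (P * L)) := by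
    rw [Real.rpow_def_of_pos (by positivity)]
    refine Real.exp_le_exp.2 ?_
    calc Real.log G * (P * δ) ≤ (Real.log a + n) * ℓ * (P * δ) := by gcongr
      _ = _ := by rw [hδ]; field_simp
  calc ‖mollify φ f x‖ ^ p x = (‖mollify φ f x‖ ^ s) ^ (p x / s) := by
        rw [← Real.rpow_mul (norm_nonneg _)]; congr 1; field_simp
    _ ≤ G ^ (p x / s) := by gcongr
    _ ≤ G ^ (1 + P * δ) := Real.rpow_le_rpow_of_exponent_le hG1 hps
    _ = G ^ (P * δ) * G := by rw [Real.rpow_add (by positivity), Real.rpow_one, mul_comm]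
    _ ≤ _ := by gcongr

theorem integral_mollify (φ : ContDiffBump (0 : Rn n)) {h : Rn n → ℝ}
    (hh : Integrable h volume) : ∫ x, mollify φ h x = ∫ x, h x := by
  rw [mollify, integral_convolution _ φ.integrable_normed hh, φ.integral_normed]
  simp

theorem integrable_mollify (φ : ContDiffBump (0 : Rn n)) {h : Rn n → ℝ}
    (hh : Integrable h volume) : Integrable (mollify φ h) volume :=
  φ.integrable_normed.integrable_convolution _ hh

end LogHolder

/-- Dominated convergence with a convergent sequence of dominating functions. -/
theorem tendsto_integral_of_tendsto_dominating {α : Type*} [MeasurableSpace α] {μ : Measure α}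
    {f G : ℕ → α → ℝ} {f₀ G₀ : α → ℝ} (hf : ∀ k, Integrable (f k) μ)
    (hG : ∀ k, Integrable (G k) μ) (hG₀ : Integrable G₀ μ)
    (hb : ∀ k, ∀ᵐ x ∂μ, |f k x| ≤ G k x)
    (hflim : ∀ᵐ x ∂μ, Tendsto (fun k => f k x) atTop (𝓝 (f₀ x)))
    (hGlim : ∀ᵐ x ∂μ, Tendsto (fun k => G k x) atTop (𝓝 (G₀ x)))
    (hGint : Tendsto (fun k => ∫ x, G k x ∂μ) atTop (𝓝 (∫ x, G₀ x ∂μ))) :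
    Tendsto (fun k => ∫ x, f k x ∂μ) atTop (𝓝 (∫ x, f₀ x ∂μ)) := by
  have hb' := ae_all_iff.2 hb
  have hb₀ : ∀ᵐ x ∂μ, |f₀ x| ≤ G₀ x := by
    filter_upwards [hb', hflim, hGlim] with x h1 h2 h3
    exact le_of_tendsto_of_tendsto' h2.abs h3 h1
  -- The positive part of `G₀ - G k` is dominated by `G₀`. Convergence of the integrals then handles
  -- the other sign, so `G k → G₀` in mean.
  have hpos : Tendsto (fun k => ∫ x, max (G₀ x - G k x) 0 ∂μ) atTop (𝓝 0) := by
    suffices h : Tendsto (fun k => ∫ x, max (G₀ x - G k x) 0 ∂μ) atTop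
        (𝓝 (∫ _, (0 : ℝ) ∂μ)) by simpa using h
    refine tendsto_integral_of_dominated_convergence G₀
      (fun k => by exact ((hG₀.sub (hG k)).pos_part).aestronglyMeasurable) hG₀ (fun k => ?_) ?_
    · filter_upwards [hb k, hb₀] with x h1 h2
      have h3 := (abs_nonneg _).trans h1
      have h4 := (abs_nonneg _).trans h2
      rw [Real.norm_of_nonneg (le_max_right _ _)]
      exact max_le (by linarith) h4
    · filter_upwards [hGlim] with x h1
      simpa using (h1.const_sub (G₀ x)).max (tendsto_const_nhds (x := (0 : ℝ)))
  have hneg : Tendsto (fun k => ∫ x, max (G k x - G₀ x) 0 ∂μ) atTop (𝓝 0) := by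
    have e : ∀ k, ∫ x, max (G k x - G₀ x) 0 ∂μ =
        (∫ x, G k x ∂μ) - (∫ x, G₀ x ∂μ) + ∫ x, max (G₀ x - G k x) 0 ∂μ := fun k => by
      rw [← integral_sub (hG k) hG₀, ← integral_add (f := fun x => G k x - G₀ x)
        (g := fun x => max (G₀ x - G k x) 0) ((hG k).sub hG₀) (hG₀.sub (hG k)).pos_part]
      refine integral_congr_ae (Eventually.of_forall fun x => ?_)
      change max (G k x - G₀ x) 0 = G k x - G₀ x + max (G₀ x - G k x) 0
      rcases le_total (G k x) (G₀ x) with h | h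
      · rw [max_eq_right (by linarith), max_eq_left (by linarith)]; ring
      · rw [max_eq_left (by linarith), max_eq_right (by linarith)]; ring
    simp only [e]
    simpa using (hGint.sub_const (∫ x, G₀ x ∂μ)).add hpos
  -- Truncated to `[-G₀, G₀]`, the sequence has a fixed majorant; the truncation error is at most
  -- the positive part of `G k - G₀`.
  have hclip : Tendsto (fun k => ∫ x, max (min (f k x) (G₀ x)) (-G₀ x) ∂μ) atTop
      (𝓝 (∫ x, f₀ x ∂μ)) := by
    refine tendsto_integral_of_dominated_convergence G₀
      (fun k => (((hf k).aestronglyMeasurable.inf hG₀.aestronglyMeasurable).sup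
        hG₀.neg.aestronglyMeasurable)) hG₀ (fun k => ?_) ?_
    · filter_upwards [hb₀] with x h2
      have h4 := (abs_nonneg _).trans h2
      exact abs_le.2 ⟨le_max_right _ _, max_le (min_le_right _ _) (by linarith)⟩
    · filter_upwards [hflim, hb₀] with x h1 h2
      have := (h1.min (tendsto_const_nhds (x := G₀ x))).max (tendsto_const_nhds (x := -G₀ x))
      rwa [min_eq_left (abs_le.1 h2).2, max_eq_left (abs_le.1 h2).1] at this
  have hdiff : Tendsto (fun k => ∫ x, f k x ∂μ - ∫ x, max (min (f k x) (G₀ x)) (-G₀ x) ∂μ) atTop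
      (𝓝 0) := by
    refine squeeze_zero_norm (fun k => ?_) hneg
    have hi : Integrable (fun x => max (min (f k x) (G₀ x)) (-G₀ x)) μ :=
      ((hf k).inf hG₀).sup hG₀.neg
    rw [← integral_sub (hf k) hi]
    refine norm_integral_le_of_norm_le ((hG k).sub hG₀).pos_part ?_
    filter_upwards [hb k, hb₀] with x h1 h2
    have h4 := (abs_nonneg _).trans h2
    have h5 := abs_le.1 h1
    rw [Real.norm_eq_abs, abs_le]
    change -max (G k x - G₀ x) 0 ≤ _ ∧ _ ≤ max (G k x - G₀ x) 0
    rcases le_total (f k x) (G₀ x) with h | h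
    · rw [min_eq_left h]
      rcases le_total (f k x) (-G₀ x) with h' | h'
      · rw [max_eq_right h']
        have := le_max_left (G k x - G₀ x) 0
        have := le_max_right (G k x - G₀ x) 0
        constructor <;> linarith
      · rw [max_eq_left h']
        have := le_max_right (G k x - G₀ x) 0
        constructor <;> linarith
    · rw [min_eq_right h, max_eq_left (show -G₀ x ≤ G₀ x by linarith)]
      have := le_max_left (G k x - G₀ x) 0
      constructor <;> linarith
  simpa using hdiff.add hclip

/-! ### Testing the equation with `(u - c) η`. -/

section WeakEquation

/-- The null set on which `A · t ξ` differs from a Borel function may depend on `(t, ξ)`. Joint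
measurability is therefore obtained over the σ-algebra of null-measurable sets, where there is
nothing to discard. -/
theorem IsCaratheodory.aestronglyMeasurable_comp {A : Rn n → ℝ → Rn n → Rn n}
    (hA : IsCaratheodory A) {u : Rn n → ℝ} {g : Rn n → Rn n} (hu : Continuous u)
    (hg : AEStronglyMeasurable g volume) :
    AEStronglyMeasurable (fun x => A x (u x) (g x)) volume := by
  have h1 : StronglyMeasurable (Function.uncurry
      fun (z : ℝ × Rn n) (x : NullMeasurableSpace (Rn n) volume) => A x z.1 z.2) := by
    refine stronglyMeasurable_uncurry_of_continuous_of_stronglyMeasurable hA.continuous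
      fun z => Measurable.stronglyMeasurable ?_
    exact (hA.measurable z.1 z.2).aemeasurable.nullMeasurable
  have h2 : Measurable fun x : NullMeasurableSpace (Rn n) volume =>
      ((((u x, g x) : ℝ × Rn n), x) : (ℝ × Rn n) × NullMeasurableSpace (Rn n) volume) := by
    refine Measurable.prodMk (Measurable.prodMk ?_ ?_) measurable_id
    · exact hu.aestronglyMeasurable.aemeasurable.nullMeasurable
    · exact hg.aemeasurable.nullMeasurable
  have h3 := h1.measurable.comp h2
  have h4 : NullMeasurable (fun x => A x (u x) (g x)) volume := h3
  exact h4.aemeasurable.aestronglyMeasurable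

/-- A crude Young inequality: replace the smaller of `m` and `s` by the larger. It needs no
conjugate exponent and so covers `q = 1`. -/
theorem mul_rpow_sub_one_le {s m q : ℝ} (hs : 0 ≤ s) (hm : 0 ≤ m) (hq : 1 ≤ q) :
    m ^ (q - 1) * s ≤ m ^ q + s ^ q := by
  have key : ∀ t : ℝ, 0 ≤ t → t ^ (q - 1) * t = t ^ q := fun t ht => by
    rcases ht.eq_or_lt with rfl | ht
    · rw [mul_zero, Real.zero_rpow (by linarith)]
    · rw [← Real.rpow_add_one ht.ne', sub_add_cancel]
  have hm' := Real.rpow_nonneg hm q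
  have hs' := Real.rpow_nonneg hs q
  rcases le_total m s with h | h
  · have := mul_le_mul_of_nonneg_right (Real.rpow_le_rpow hm h (by linarith : 0 ≤ q - 1)) hs
    rw [key s hs] at this
    linarith
  · have := mul_le_mul_of_nonneg_left h (Real.rpow_nonneg hm (q - 1))
    rw [key m hm] at this
    linarith

theorem integrable_inner_of_hasCompactSupport {a ψ : Rn n → Rn n}
    (ha : LocallyIntegrable a volume) (hψ : Continuous ψ) (hψc : HasCompactSupport ψ) :
    Integrable (fun x => inner ℝ (a x) (ψ x)) volume := by
  have ha' : LocallyIntegrable (fun x => ‖a x‖) volume :=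
    ha.mono ha.aestronglyMeasurable.norm (by simp)
  refine (ha'.integrable_smul_right_of_hasCompactSupport hψ.norm hψc.norm).mono'
    (ha.aestronglyMeasurable.inner hψ.aestronglyMeasurable)
    (Eventually.of_forall fun x => norm_inner_le_norm _ _)

theorem continuous_gradient {η : Rn n → ℝ} (hη : ContDiff ℝ 1 η) : Continuous (∇ η) :=
  (InnerProductSpace.toDual ℝ (Rn n)).symm.continuous.comp (hη.continuous_fderiv one_ne_zero)

theorem gradient_eq_zero_of_notMem_tsupport {η : Rn n → ℝ} {x : Rn n} (hx : x ∉ tsupport η) :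
    ∇ η x = 0 := by
  rw [gradient, fderiv_of_notMem_tsupport ℝ hx, map_zero]

theorem HasCompactSupport.gradient {η : Rn n → ℝ} (hη : HasCompactSupport η) :
    HasCompactSupport (∇ η) :=
  hη.mono' fun _ hx => by_contra fun h => hx (gradient_eq_zero_of_notMem_tsupport h)

theorem hasGradientAt_mul {v η : Rn n → ℝ} {v' η' x : Rn n} (hv : HasGradientAt v v' x)
    (hη : HasGradientAt η η' x) :
    HasGradientAt (fun y => v y * η y) (η x • v' + v x • η') x := by
  rw [hasGradientAt_iff_hasFDerivAt] at *
  have e : InnerProductSpace.toDual ℝ (Rn n) (η x • v' + v x • η') =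
      v x • InnerProductSpace.toDual ℝ (Rn n) η' + η x • InnerProductSpace.toDual ℝ (Rn n) v' := by
    simp [add_comm]
  rw [e]
  exact hv.mul hη

/-- The weak equation may be tested with `(u - c) η`. -/
theorem integral_inner_eq_of_weak_eq {p : Rn n → ℝ} (hp : IsLogHolderExponent p)
    {u : Rn n → ℝ} {g a : Rn n → Rn n} (hu : Continuous u) (hg : IsWeakGradient u g)
    (hgp : Integrable (fun x => ‖g x‖ ^ p x) volume) (ha : AEStronglyMeasurable a volume)
    {B : ℝ} (hB : 0 ≤ B) (haB : ∀ x, ‖a x‖ ≤ B * ‖g x‖ ^ (p x - 1))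
    (hweak : ∀ φ : Rn n → ℝ, ContDiff ℝ ∞ φ → HasCompactSupport φ →
      ∫ x, inner ℝ (a x) (∇ φ x) = 0)
    {η : Rn n → ℝ} (hη : ContDiff ℝ ∞ η) (hηc : HasCompactSupport η) (c : ℝ) :
    Integrable (fun x => η x * inner ℝ (a x) (g x)) volume ∧
    ∫ x, η x * inner ℝ (a x) (g x) = -∫ x, (u x - c) * inner ℝ (a x) (∇ η x) := by
  have hgm := hg.locallyIntegrable_grad.aestronglyMeasurable
  set h : Rn n → ℝ := fun x => ‖g x‖ ^ p x with hh
  have h0 : ∀ x, 0 ≤ h x := fun x => by positivity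
  have hη1 : ContDiff ℝ 1 η := hη.of_le (by simp)
  obtain ⟨N, hN⟩ := hη.continuous.bounded_above_of_compact_support hηc
  have hN0 : 0 ≤ N := (norm_nonneg _).trans (hN 0)
  -- Local integrability follows from `|g|^(p-1) ≤ |g|^p + 1`.
  have hal : LocallyIntegrable a volume := by
    have hc : LocallyIntegrable (fun x => B * (1 + h x)) volume :=
      ((locallyIntegrable_const (1 : ℝ)).add hgp.locallyIntegrable).smul B
    refine hc.mono ha (Eventually.of_forall fun x => ?_)
    rw [Real.norm_of_nonneg (mul_nonneg hB (by linarith [h0 x]))]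
    refine (haB x).trans (mul_le_mul_of_nonneg_left ?_ hB)
    have := mul_rpow_sub_one_le zero_le_one (norm_nonneg (g x)) (hp.one_le x)
    rw [Real.one_rpow, mul_one] at this
    linarith
  have hηa : ∀ (x : Rn n) (w : Rn n), |η x * inner ℝ (a x) w| ≤
      B * |η x| * (h x + ‖w‖ ^ p x) := fun x w => by
    rw [abs_mul]
    calc |η x| * |inner ℝ (a x) w| ≤ |η x| * (B * ‖g x‖ ^ (p x - 1) * ‖w‖) := by
          gcongr
          exact (abs_real_inner_le_norm _ _).trans
            (mul_le_mul_of_nonneg_right (haB x) (norm_nonneg _))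
      _ = B * |η x| * (‖g x‖ ^ (p x - 1) * ‖w‖) := by ring
      _ ≤ _ := mul_le_mul_of_nonneg_left
          (mul_rpow_sub_one_le (norm_nonneg _) (norm_nonneg _) (hp.one_le x)) (by positivity)
  have hI : Integrable (fun x => η x * inner ℝ (a x) (g x)) volume := by
    refine (hgp.const_mul (2 * (B * N))).mono'
      (hη.continuous.aestronglyMeasurable.mul (ha.inner hgm)) (Eventually.of_forall fun x => ?_)
    refine (hηa x (g x)).trans ?_
    calc B * |η x| * (h x + h x) ≤ B * N * (h x + h x) := by
          gcongr
          exact hN x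
      _ = _ := by ring
  refine ⟨hI, ?_⟩
  obtain ⟨C, hC, hCb⟩ := exists_norm_mollify_rpow_le hp hgm hgp
  set U : ℕ → Rn n → ℝ := fun k => mollify (bumpSeq n k) u with hU
  set V : ℕ → Rn n → Rn n := fun k => mollify (bumpSeq n k) g with hV
  have hUs : ∀ k, ContDiff ℝ ∞ (U k) := fun k => contDiff_mollify _ hg.locallyIntegrable
  have hVs : ∀ k, Continuous (V k) := fun k =>
    (contDiff_mollify _ hg.locallyIntegrable_grad).continuous
  have hI1 : ∀ k, Integrable (fun x => η x * inner ℝ (a x) (V k x)) volume := fun k => by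
    have h1 : Continuous fun x => η x • V k x := hη.continuous.smul (hVs k)
    have h2 : HasCompactSupport fun x => η x • V k x := hηc.smul_right
    exact (integrable_inner_of_hasCompactSupport hal h1 h2).congr
      (Eventually.of_forall fun x => real_inner_smul_right _ _ _)
  have hI2 : ∀ k, Integrable (fun x => (U k x - c) * inner ℝ (a x) (∇ η x)) volume := fun k => by
    have h1 : Continuous fun x => (U k x - c) • ∇ η x :=
      ((hUs k).continuous.sub continuous_const).smul (continuous_gradient hη1)
    have h2 : HasCompactSupport fun x => (U k x - c) • ∇ η x :=
      hηc.gradient.mono fun x hx h => hx (smul_eq_zero_of_right _ h)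
    exact (integrable_inner_of_hasCompactSupport hal h1 h2).congr
      (Eventually.of_forall fun x => real_inner_smul_right _ _ _)
  have hsum : ∀ k, (∫ x, η x * inner ℝ (a x) (V k x)) +
      ∫ x, (U k x - c) * inner ℝ (a x) (∇ η x) = 0 := fun k => by
    rw [← integral_add (hI1 k) (hI2 k), ← hweak (fun x => (U k x - c) * η x)
      (((hUs k).sub contDiff_const).mul hη) hηc.mul_left]
    refine integral_congr_ae (Eventually.of_forall fun x => ?_)
    have h1 : HasGradientAt (fun y => U k y - c) (V k x) x := by
      have := hasGradientAt_mollify (bumpSeq n k) hg x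
      rw [hasGradientAt_iff_hasFDerivAt] at *
      exact this.sub_const c
    have h2 : HasGradientAt η (∇ η x) x :=
      (hη1.differentiable one_ne_zero x).hasGradientAt
    simp only [(hasGradientAt_mul h1 h2).gradient, inner_add_right, real_inner_smul_right]
  have hlim1 : Tendsto (fun k => ∫ x, η x * inner ℝ (a x) (V k x)) atTop
      (𝓝 (∫ x, η x * inner ℝ (a x) (g x))) := by
    have hIη : Integrable (fun x => B * |η x| * (h x + C)) volume := by
      have e1 : Integrable (fun x => |η x|) volume :=
        (hη.continuous.abs).integrable_of_hasCompactSupport hηc.norm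
      have e2 : Integrable (fun x => |η x| * h x) volume := by
        refine (hgp.const_mul N).mono' (hη.continuous.abs.aestronglyMeasurable.mul
          hgp.aestronglyMeasurable) (Eventually.of_forall fun x => ?_)
        rw [Real.norm_of_nonneg (mul_nonneg (abs_nonneg _) (h0 x))]
        exact mul_le_mul_of_nonneg_right (hN x) (h0 x)
      refine ((e2.add (e1.const_mul C)).const_mul B).congr (Eventually.of_forall fun x => ?_)
      simp only [Pi.add_apply]
      ring
    have hm : ∀ k, Integrable (fun x => B * N * C * mollify (bumpSeq n k) h x) volume :=
      fun k => (integrable_mollify _ hgp).const_mul _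
    -- The majorant contains the mollification of `|g|^p`. It varies with `k`, but converges almost
    -- everywhere and its integral is independent of `k`.
    refine tendsto_integral_of_tendsto_dominating
      (G := fun k x => B * |η x| * (h x + C) + B * N * C * mollify (bumpSeq n k) h x)
      (G₀ := fun x => B * |η x| * (h x + C) + B * N * C * h x) hI1 (fun k => hIη.add (hm k))
      (hIη.add (hgp.const_mul _)) (fun k => Eventually.of_forall fun x => ?_) ?_ ?_ ?_
    · have hM0 := mollify_nonneg (bumpSeq n k) h0 x
      calc _ ≤ B * |η x| * (h x + ‖V k x‖ ^ p x) := hηa x _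
        _ ≤ B * |η x| * (h x + C * (1 + mollify (bumpSeq n k) h x)) := by
            gcongr
            exact hCb k x
        _ = B * |η x| * (h x + C) + B * |η x| * C * mollify (bumpSeq n k) h x := by ring
        _ ≤ _ := by
            gcongr
            exact hN x
    · filter_upwards [ae_tendsto_mollify hg.locallyIntegrable_grad] with x hx
      exact ((tendsto_const_nhds (x := a x)).inner hx).const_mul _
    · filter_upwards [ae_tendsto_mollify hgp.locallyIntegrable] with x hx
      exact (hx.const_mul _).const_add _
    · have e : ∀ k, ∫ x, (B * |η x| * (h x + C) + B * N * C * mollify (bumpSeq n k) h x) =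
          ∫ x, (B * |η x| * (h x + C) + B * N * C * h x) := fun k => by
        rw [integral_add hIη (hm k), integral_add hIη (hgp.const_mul _), integral_const_mul,
          integral_const_mul, integral_mollify _ hgp]
      simp only [e]
      exact tendsto_const_nhds
  have hlim2 : Tendsto (fun k => ∫ x, (U k x - c) * inner ℝ (a x) (∇ η x)) atTop
      (𝓝 (∫ x, (u x - c) * inner ℝ (a x) (∇ η x))) := by
    -- All mollifiers have radius at most `1`, so on the support of `η` the mollified functions are
    -- bounded by the maximum of `|u|` on its closed `1`-neighbourhood.
    obtain ⟨M, hM⟩ := (hηc.isCompact.cthickening (r := 1)).exists_bound_of_continuousOn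
      hu.continuousOn
    have hUM : ∀ k, ∀ x ∈ tsupport η, ‖U k x‖ ≤ M := fun k x hx => by
      rw [hU]
      simp only [mollify_apply]
      refine (norm_integral_le_of_norm_le_const (C := M) ?_).trans (by simp)
      filter_upwards [ae_bumpMeasure_mem_ball (bumpSeq n k)] with t ht
      refine hM _ (Metric.mem_cthickening_of_dist_le _ x _ _ hx ?_)
      rw [dist_eq_norm, sub_sub_cancel_left, norm_neg]
      have h1 : (bumpSeq n k).rOut ≤ 1 := by
        simp only [bumpSeq]
        rw [div_le_one (by positivity)]
        linarith [(Nat.cast_nonneg k : (0 : ℝ) ≤ k)]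
      exact (mem_ball_zero_iff.1 ht).le.trans h1
    have hIg := integrable_inner_of_hasCompactSupport hal (continuous_gradient hη1) hηc.gradient
    refine tendsto_integral_of_dominated_convergence
      (fun x => (M + |c|) * ‖inner ℝ (a x) (∇ η x)‖) (fun k => (hI2 k).aestronglyMeasurable)
      (hIg.norm.const_mul _) (fun k => Eventually.of_forall fun x => ?_)
      (Eventually.of_forall fun x => ?_)
    · by_cases hx : x ∈ tsupport η
      · rw [norm_mul]
        gcongr
        exact (norm_sub_le _ _).trans (add_le_add (hUM k x hx) le_rfl)
      · simp [gradient_eq_zero_of_notMem_tsupport hx]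
    · exact ((tendsto_mollify_of_continuous hu x).sub_const c).mul_const _
  have := tendsto_nhds_unique (hlim1.add hlim2) (by simp only [hsum]; exact tendsto_const_nhds)
  linarith

end WeakEquation

/-! ### The energy estimate and the Liouville theorem. -/

section Liouville

/-- Each mollification of `u` has zero gradient, hence is constant; continuity of `u` gives
convergence at every point. -/
theorem eq_of_isWeakGradient_ae_eq_zero {u : Rn n → ℝ} {g : Rn n → Rn n} (hu : Continuous u)
    (hg : IsWeakGradient u g) (h0 : ∀ᵐ x, g x = 0) (x y : Rn n) : u x = u y := by
  have hm : ∀ k z, mollify (bumpSeq n k) g z = 0 := fun k z => by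
    rw [mollify_apply]
    refine integral_eq_zero_of_ae ?_
    exact (bumpMeasure_absolutelyContinuous _).ae_le
      ((quasiMeasurePreserving_sub_left_of_right_invariant volume z).ae h0)
  have hconst : ∀ k, mollify (bumpSeq n k) u x = mollify (bumpSeq n k) u y := fun k => by
    refine is_const_of_fderiv_eq_zero (𝕜 := ℝ)
      ((contDiff_mollify (bumpSeq n k) hg.locallyIntegrable).differentiable (by simp))
      (fun z => ?_) x y
    rw [(hasGradientAt_iff_hasFDerivAt.1 (hasGradientAt_mollify _ hg z)).fderiv, hm, map_zero]
  refine tendsto_nhds_unique (tendsto_mollify_of_continuous hu x) ?_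
  simp only [hconst]
  exact tendsto_mollify_of_continuous hu y

/-- Cutoff functions adapted to the dilates of the inner annulus. -/
theorem exists_cutoff (n : ℕ) : ∃ D : ℝ, 0 ≤ D ∧ ∀ (x₀ : Rn n) (R : ℝ), 0 < R →
    ∃ η : Rn n → ℝ, ContDiff ℝ ∞ η ∧ HasCompactSupport η ∧ (∀ x, 0 ≤ η x) ∧
      (∀ x ∈ Metric.ball x₀ R, η x = 1) ∧ (∀ x, ‖∇ η x‖ ≤ D * R⁻¹) ∧
      ∀ x ∉ scaledSet x₀ R (innerAnnulus n), ∇ η x = 0 := by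
  let ψ : ContDiffBump (0 : Rn n) := ⟨5 / 4, 7 / 4, by norm_num, by norm_num⟩
  have hψ : ContDiff ℝ ∞ ψ := ψ.contDiff
  have hψ1 : ContDiff ℝ 1 ψ := ψ.contDiff
  obtain ⟨D, hD⟩ := (continuous_gradient hψ1).bounded_above_of_compact_support
    ψ.hasCompactSupport.gradient
  refine ⟨D, (norm_nonneg _).trans (hD 0), fun x₀ R hR => ?_⟩
  have hτ : ∀ x, HasFDerivAt (fun x : Rn n => R⁻¹ • (x - x₀))
      (R⁻¹ • ContinuousLinearMap.id ℝ (Rn n)) x := fun x =>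
    ((hasFDerivAt_id x).sub_const x₀).const_smul R⁻¹
  have hgrad : ∀ x, ∇ (fun x => ψ (R⁻¹ • (x - x₀))) x = R⁻¹ • ∇ ψ (R⁻¹ • (x - x₀)) := fun x => by
    have h1 := ((hψ1.differentiable one_ne_zero (R⁻¹ • (x - x₀))).hasFDerivAt).comp x (hτ x)
    have h2 : fderiv ℝ (fun x => ψ (R⁻¹ • (x - x₀))) x = _ := h1.fderiv
    rw [gradient, gradient, h2, ContinuousLinearMap.comp_smul, ContinuousLinearMap.comp_id]
    simp
  refine ⟨fun x => ψ (R⁻¹ • (x - x₀)), hψ.comp (by fun_prop), ?_, fun x => ψ.nonneg,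
    fun x hx => ?_, fun x => ?_, fun x hx => ?_⟩
  · exact ψ.hasCompactSupport.comp_homeomorph
      ((Homeomorph.subRight x₀).trans (Homeomorph.smulOfNeZero R⁻¹ (inv_ne_zero hR.ne')))
  · refine ψ.one_of_mem_closedBall ?_
    rw [mem_closedBall_zero_iff, norm_smul, norm_inv, Real.norm_of_nonneg hR.le,
      inv_mul_le_iff₀ hR]
    rw [Metric.mem_ball, dist_eq_norm] at hx
    change ‖x - x₀‖ ≤ R * (5 / 4)
    linarith
  · rw [hgrad, norm_smul, norm_inv, Real.norm_of_nonneg hR.le, mul_comm]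
    exact mul_le_mul_of_nonneg_right (hD _) (by positivity)
  · rw [hgrad]
    set y := R⁻¹ • (x - x₀)
    suffices ∇ ψ y = 0 by rw [this, smul_zero]
    have hy : ¬(5 / 4 ≤ ‖y‖ ∧ ‖y‖ ≤ 7 / 4) := hx
    rcases lt_or_ge ‖y‖ (5 / 4) with h | h
    · have : (ψ : Rn n → ℝ) =ᶠ[𝓝 y] 1 := ψ.eventuallyEq_one_of_mem_ball (by simpa using h)
      rw [gradient, this.fderiv_eq]
      simp
    · refine gradient_eq_zero_of_notMem_tsupport ?_
      rw [ψ.tsupport_eq, mem_closedBall_zero_iff]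
      exact fun h' => hy ⟨h, h'⟩

theorem scaledSet_unitAnnulus_subset (x₀ : Rn n) {R : ℝ} (hR : 0 < R) :
    scaledSet x₀ R (unitAnnulus n) ⊆ Metric.ball x₀ (2 * R) \ Metric.ball x₀ R := by
  intro x hx
  have h : 1 < ‖R⁻¹ • (x - x₀)‖ ∧ ‖R⁻¹ • (x - x₀)‖ < 2 := hx
  rw [norm_smul, norm_inv, Real.norm_of_nonneg hR.le, lt_inv_mul_iff₀ hR, inv_mul_lt_iff₀ hR] at h
  rw [Set.mem_sdiff, Metric.mem_ball, Metric.mem_ball, dist_eq_norm]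
  constructor <;> linarith [h.1, h.2]

/-- The energy inside a ball is controlled by the energy outside it if the exponent is constant
on the adjacent annulus. -/
theorem exists_energy_ball_le (hn : 2 ≤ n) {p : Rn n → ℝ} (hp : IsLogHolderExponent p)
    {q : ℝ} (hq : 1 ≤ q) {u : Rn n → ℝ} {g a : Rn n → Rn n} (hu : Continuous u)
    (hg : IsWeakGradient u g) (hgp : Integrable (fun x => ‖g x‖ ^ p x) volume)
    (ha : AEStronglyMeasurable a volume) {α B : ℝ} (hα : 0 < α) (hB : 0 ≤ B)
    (haα : ∀ x, α * ‖g x‖ ^ p x ≤ inner ℝ (a x) (g x))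
    (haB : ∀ x, ‖a x‖ ≤ B * ‖g x‖ ^ (p x - 1))
    (hweak : ∀ φ : Rn n → ℝ, ContDiff ℝ ∞ φ → HasCompactSupport φ →
      ∫ x, inner ℝ (a x) (∇ φ x) = 0) :
    ∃ C : ℝ≥0∞, C ≠ ⊤ ∧ ∀ (x₀ : Rn n) (R : ℝ), 0 < R →
      (∀ x ∈ Metric.ball x₀ (2 * R) \ Metric.ball x₀ R, p x = q) →
      ENNReal.ofReal α * ∫⁻ x in Metric.ball x₀ R, ‖g x‖ₑ ^ p x ≤
        C * ∫⁻ x in (Metric.ball x₀ R)ᶜ, ‖g x‖ₑ ^ p x := by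
  obtain ⟨C, hC, hCP⟩ := exists_poincare_annulus hn hq
  obtain ⟨D, hD, hcut⟩ := exists_cutoff n
  have hq0 : 0 ≤ q := zero_le_one.trans hq
  -- The `1` comes from the gradient term in Young's inequality, the `C` from the Poincaré term,
  -- where the powers of `R` cancel by `hRq`.
  refine ⟨ENNReal.ofReal (B * D) * (1 + C), ENNReal.mul_ne_top ENNReal.ofReal_ne_top
    (ENNReal.add_ne_top.2 ⟨ENNReal.one_ne_top, hC⟩), fun x₀ R hR hpq => ?_⟩
  obtain ⟨η, hη, hηc, hη0, hη1, hηD, hηK⟩ := hcut x₀ R hR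
  obtain ⟨c, hc⟩ := hCP u g hu hg x₀ R hR
  obtain ⟨hI, hE⟩ := integral_inner_eq_of_weak_eq hp hu hg hgp ha hB haB hweak hη hηc c
  set K := scaledSet x₀ R (innerAnnulus n) with hK
  set V := scaledSet x₀ R (unitAnnulus n) with hV
  have hKm : MeasurableSet K := measurableSet_scaledSet _ _ (measurableSet_innerAnnulus n)
  have hVm : MeasurableSet V := measurableSet_scaledSet _ _ (measurableSet_unitAnnulus n)
  have hVs := scaledSet_unitAnnulus_subset x₀ hR
  have hKV : K ⊆ V := preimage_mono fun y hy => ⟨by linarith [hy.1], by linarith [hy.2]⟩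
  have hpos : ∀ x, 0 ≤ η x * inner ℝ (a x) (g x) := fun x =>
    mul_nonneg (hη0 x) ((by positivity : 0 ≤ α * ‖g x‖ ^ p x).trans (haα x))
  have hRq : ENNReal.ofReal R⁻¹ ^ q * ENNReal.ofReal R ^ q = 1 := by
    rw [← ENNReal.mul_rpow_of_nonneg _ _ hq0, ← ENNReal.ofReal_mul (by positivity),
      inv_mul_cancel₀ hR.ne', ENNReal.ofReal_one, ENNReal.one_rpow]
  have hgm : AEMeasurable (fun x => ‖g x‖ₑ ^ q) (volume.restrict K) :=
    (hg.locallyIntegrable_grad.aestronglyMeasurable.enorm.pow_const q).restrict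
  calc ENNReal.ofReal α * ∫⁻ x in Metric.ball x₀ R, ‖g x‖ₑ ^ p x
      = ∫⁻ x in Metric.ball x₀ R, ENNReal.ofReal α * ‖g x‖ₑ ^ p x :=
        (lintegral_const_mul' _ _ ENNReal.ofReal_ne_top).symm
    _ ≤ ∫⁻ x in Metric.ball x₀ R, ENNReal.ofReal (η x * inner ℝ (a x) (g x)) := by
        refine setLIntegral_mono' measurableSet_ball fun x hx => ?_
        rw [enorm_rpow_eq_ofReal _ (zero_le_one.trans (hp.one_le x)),
          ← ENNReal.ofReal_mul hα.le, hη1 x hx, one_mul]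
        exact ENNReal.ofReal_le_ofReal (haα x)
    _ ≤ ∫⁻ x, ENNReal.ofReal (η x * inner ℝ (a x) (g x)) := setLIntegral_le_lintegral _ _
    _ = ENNReal.ofReal (-∫ x, (u x - c) * inner ℝ (a x) (∇ η x)) := by
        rw [← hE, ofReal_integral_eq_lintegral_ofReal hI (Eventually.of_forall hpos)]
    _ ≤ ‖∫ x, (u x - c) * inner ℝ (a x) (∇ η x)‖ₑ := by
        rw [← ofReal_norm]
        exact ENNReal.ofReal_le_ofReal (neg_le_abs _)
    _ ≤ ∫⁻ x, ‖(u x - c) * inner ℝ (a x) (∇ η x)‖ₑ := enorm_integral_le_lintegral_enorm _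
    -- `∇ η` vanishes off `K` and is at most `D / R`. Young's inequality is applied to `|g|` and `|u
    -- - c| / R` with the constant exponent `q`.
    _ ≤ ∫⁻ x in K, ENNReal.ofReal (B * D) *
          (‖g x‖ₑ ^ q + ENNReal.ofReal R⁻¹ ^ q * ‖u x - c‖ₑ ^ q) := by
        rw [← lintegral_indicator hKm]
        refine lintegral_mono fun x => ?_
        by_cases hx : x ∈ K
        · rw [indicator_of_mem hx]
          have hpx : p x = q := hpq x (hVs (hKV hx))
          have hax := haB x
          rw [hpx] at hax
          rw [← ENNReal.mul_rpow_of_nonneg _ _ hq0, ← ofReal_norm (u x - c),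
            ← ENNReal.ofReal_mul (by positivity), enorm_rpow_eq_ofReal _ hq0,
            ENNReal.ofReal_rpow_of_nonneg (by positivity) hq0,
            ← ENNReal.ofReal_add (by positivity) (by positivity),
            ← ENNReal.ofReal_mul (by positivity), ← ofReal_norm]
          refine ENNReal.ofReal_le_ofReal ?_
          rw [norm_mul]
          calc ‖u x - c‖ * ‖inner ℝ (a x) (∇ η x)‖
              ≤ ‖u x - c‖ * (B * ‖g x‖ ^ (q - 1) * (D * R⁻¹)) := by
                gcongr
                exact (norm_inner_le_norm _ _).trans
                  (mul_le_mul hax (hηD x) (norm_nonneg _) (by positivity))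
            _ = B * D * (‖g x‖ ^ (q - 1) * (R⁻¹ * ‖u x - c‖)) := by ring
            _ ≤ _ := by
                gcongr
                exact mul_rpow_sub_one_le (by positivity) (norm_nonneg _) hq
        · simp [hηK x hx]
    _ = ENNReal.ofReal (B * D) * ((∫⁻ x in K, ‖g x‖ₑ ^ q) +
          ENNReal.ofReal R⁻¹ ^ q * ∫⁻ x in K, ‖u x - c‖ₑ ^ q) := by
        rw [lintegral_const_mul' _ _ ENNReal.ofReal_ne_top, lintegral_add_left' hgm,
          lintegral_const_mul' _ _ (ENNReal.rpow_ne_top_of_nonneg hq0 ENNReal.ofReal_ne_top)]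
    _ ≤ ENNReal.ofReal (B * D) * ((∫⁻ x in V, ‖g x‖ₑ ^ q) +
          ENNReal.ofReal R⁻¹ ^ q * (C * (ENNReal.ofReal R ^ q * ∫⁻ x in V, ‖g x‖ₑ ^ q))) := by
        gcongr
    _ = ENNReal.ofReal (B * D) * (1 + C * (ENNReal.ofReal R⁻¹ ^ q * ENNReal.ofReal R ^ q)) *
          ∫⁻ x in V, ‖g x‖ₑ ^ q := by ring
    _ = ENNReal.ofReal (B * D) * (1 + C) * ∫⁻ x in V, ‖g x‖ₑ ^ p x := by
        rw [hRq, mul_one]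
        congr 1
        refine setLIntegral_congr_fun hVm fun x hx => ?_
        simp only [hpq x (hVs hx)]
    -- The annulus lies outside the ball, so nothing has to be absorbed into the left-hand side.
    _ ≤ _ := by
        gcongr
        exact fun x hx => (hVs hx).2

end Liouville

theorem theorem3p4 (n : ℕ) (hn : 2 ≤ n)
    (p : Rn n → ℝ) (hp : IsLogHolderExponent p)
    (A : Rn n → ℝ → Rn n → Rn n) (hA : HasVarGrowth p A)
    (x₀ : Rn n) (R : ℕ → ℝ) (hRpos : ∀ k, 0 < R k) (hRmono : Monotone R)
    (hRtop : Tendsto R atTop atTop)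
    (q : ℝ) (hq1 : 1 ≤ q) (hqp : q ≤ essSup p volume)
    (hpq : ∀ k, ∀ x ∈ Metric.ball x₀ (2 * R k) \ Metric.ball x₀ (R k), p x = q)
    (u : Rn n → ℝ) (g : Rn n → Rn n) (hu : IsAHarmonic p A u g)
    (hfin : varModular p univ g < ⊤) :
    ∃ c : ℝ, ∀ x, u x = c := by
  obtain ⟨a, b, -, -, ⟨α, hα, haα⟩, ⟨B, hbB⟩, hab, hlow, hupp⟩ := hA.growth
  have hg := hu.sobolev.weakGradient
  have hgm := hg.locallyIntegrable_grad.aestronglyMeasurable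
  have hB : 0 ≤ B := hα.le.trans ((haα 0).trans ((hab 0).trans (hbB 0)))
  have hp0 : ∀ x, 0 ≤ p x := fun x => zero_le_one.trans (hp.one_le x)
  set f : Rn n → ℝ≥0∞ := fun x => ‖g x‖ₑ ^ p x with hf
  have hfm : AEMeasurable f volume := hgm.enorm.pow hp.continuous.measurable.aemeasurable
  have hfin' : ∫⁻ x, f x < ⊤ := by simpa [varModular] using hfin
  have hgp : Integrable (fun x => ‖g x‖ ^ p x) volume := by
    refine ⟨(hgm.norm.aemeasurable.pow
      hp.continuous.measurable.aemeasurable).aestronglyMeasurable, ?_⟩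
    rw [hasFiniteIntegral_iff_ofReal (Eventually.of_forall fun x => by positivity)]
    simpa only [← enorm_rpow_eq_ofReal _ (hp0 _)] using hfin'
  obtain ⟨C, hC, H⟩ := exists_energy_ball_le hn hp hq1 hu.continuous hg hgp
    (hA.caratheodory.aestronglyMeasurable_comp hu.continuous hgm) hα hB
    (fun x => (mul_le_mul_of_nonneg_right (haα x) (by positivity)).trans (hlow x (u x) (g x)))
    (fun x => (hupp x (u x) (g x)).trans (mul_le_mul_of_nonneg_right (hbB x) (by positivity)))
    hu.weak_eq
  set s : ℕ → Set (Rn n) := fun k => (Metric.ball x₀ (R k))ᶜ with hs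
  have hsm : ∀ k, MeasurableSet (s k) := fun k => measurableSet_ball.compl
  -- Adding `α` times the energy outside the ball makes the left-hand side independent of `k`.
  have hbound : ∀ k, ENNReal.ofReal α * ∫⁻ x, f x ≤
      (C + ENNReal.ofReal α) * ∫⁻ x in s k, f x := fun k => by
    rw [← lintegral_add_compl f (measurableSet_ball (x := x₀) (ε := R k)), mul_add, add_mul]
    exact add_le_add (H x₀ (R k) (hRpos k) (hpq k)) le_rfl
  have hlim : Tendsto (fun k => ∫⁻ x in s k, f x) atTop (𝓝 0) := by
    -- Continuity from above of the finite measure with density `|g|^p`, along complements of balls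
    -- that decrease to the empty set.
    have h := tendsto_measure_iInter_atTop (μ := volume.withDensity f) (s := s)
      (fun k => (hsm k).nullMeasurableSet)
      (fun i j hij => compl_subset_compl.2 (Metric.ball_subset_ball (hRmono hij)))
      ⟨0, ((measure_mono (subset_univ _)).trans_lt
        (by rwa [withDensity_apply _ MeasurableSet.univ, Measure.restrict_univ])).ne⟩
    have hempty : ⋂ k, s k = ∅ := by
      rw [eq_empty_iff_forall_notMem]
      intro x hx
      obtain ⟨k, hk⟩ := (hRtop.eventually_gt_atTop (dist x x₀)).exists
      exact mem_iInter.1 hx k hk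
    rw [hempty, measure_empty] at h
    simpa only [Function.comp_def, withDensity_apply _ (hsm _)] using h
  have hzero : ∫⁻ x, f x = 0 := by
    have h := ge_of_tendsto' (ENNReal.Tendsto.const_mul hlim
      (Or.inr (ENNReal.add_ne_top.2 ⟨hC, ENNReal.ofReal_ne_top⟩))) hbound
    rw [mul_zero, nonpos_iff_eq_zero, mul_eq_zero, ENNReal.ofReal_eq_zero] at h
    exact h.resolve_left hα.not_ge
  have hg0 : ∀ᵐ x, g x = 0 := by
    filter_upwards [(lintegral_eq_zero_iff' hfm).1 hzero] with x hx
    have h1 : 0 < p x := zero_lt_one.trans_le (hp.one_le x)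
    have h2 : ‖g x‖ₑ ^ p x = 0 := hx
    rw [ENNReal.rpow_eq_zero_iff_of_pos h1] at h2
    exact enorm_eq_zero.1 h2
  exact ⟨u 0, fun x => eq_of_isWeakGradient_ae_eq_zero hu.continuous hg hg0 x 0⟩
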